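/- Let $\varepsilon\in[0,1]$ and $\lambda,\mu\ge 0$. All spaces are finite-dimensional, logarithms are base $2$, $H$ is the von Neumann entropy, and $H_2(p)=-p\log p-(1-p)\log(1-p)$ (with $0\log 0=0$). For a quantum channel $\mathcal N^{A'\to B}$, consider all classical-quantum states $$\sigma^{XYBE}=\sum_{x,y}p_{X,Y}(x,y)\,|x\rangle\langle x|^X\otimes|y\rangle\langle y|^Y\otimes U\rho_{x,y}^{A'}U^\dagger ,$$ where $X,Y$ have finite alphabets, $p_{X,Y}$ is a probability distribution, the $\rho_{x,y}$ are (mixed) density operators on $A'$, and $U:A'\to BE$ is an isometric extension of $\mathcal N$. With the usual (conditional) quantum mutual informations $I(A;B)=H(A)+H(B)-H(AB)$ and $I(A;B|C)=H(AC)+H(BC)-H(C)-H(ABC)$, the private dynamic capacity formula of $\mathcal N$ is $$P_{\lambda,\mu}(\mathcal N)=\max_\sigma\; I(YX;B)_\sigma+\lambda\left[I(Y;B|X)_\sigma-I(Y;E|X)_\sigma\right]+\mu\left[I(YX;B)_\sigma-I(Y;E|X)_\sigma\right],$$ and the one-shot region $\mathcal C^{(1)}(\mathcal N)$ is the set of all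 $(R,P,S)\in\mathbb R^3$ for which some such $\sigma$ satisfies $R+P\le I(YX;B)_\sigma$, $P+S\le I(Y;B|X)_\sigma-I(Y;E|X)_\sigma$ and $R+P+S\le I(YX;B)_\sigma-I(Y;E|X)_\sigma$. Let $\mathcal N_\varepsilon$ be the qubit erasure channel $\mathcal N_\varepsilon(\rho)=(1-\varepsilon)\rho+\varepsilon\,\mathrm{Tr}(\rho)\,|e\rangle\langle e|$, whose output space is spanned by $|0\rangle,|1\rangle$ and the orthogonal erasure flag $|e\rangle$. Then the maxima defining $P_{\lambda,\mu}(\mathcal N_\varepsilon)$ and $P_{\lambda,\mu}(\mathcal N_\varepsilon\otimes\mathcal N_\varepsilon)$ are attained, and: (1) $\displaystyle P_{\lambda,\mu}(\mathcal N_\varepsilon)=\max_{p\in[0,1/2]}\;(1-\varepsilon)+\lambda(1-2\varepsilon)H_2(p)+\mu\big((1-\varepsilon)-\varepsilon H_2(p)\big)$; (2) $\mathcal C^{(1)}(\mathcal N_\varepsilon)$ is the set of all $(R,P,S)\in\mathbb R^3$ such that, for some $p\in[0,1/2]$, $$R+P\le 1-\varepsilon,\qquad P+S\le(1-2\varepsilon)H_2(p),\qquad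 R+P+S\le 1-\varepsilon-\varepsilon H_2(p);$$ (3) $P_{\lambda,\mu}(\mathcal N_\varepsilon\otimes\mathcal N_\varepsilon)=P_{\lambda,\mu}(\mathcal N_\varepsilon)+P_{\lambda,\mu}(\mathcal N_\varepsilon)$ (in particular whenever $\lambda(1-2\varepsilon)\ge\mu\varepsilon$). -/

import Mathlib

open scoped Kronecker Matrix ComplexOrder

namespace PrivateDynamic

noncomputable section

/-- Density operators on the Hilbert space with orthonormal basis indexed by `K`. -/
def IsDensity {K : Type} [Fintype K] (ρ : Matrix K K ℂ) : Prop :=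
  ρ.PosSemidef ∧ ρ.trace = 1

/-- The von Neumann entropy `-Tr (ρ log₂ ρ)` in bits (`0 log 0 = 0`), where `ρ log₂ ρ` is
formed by the functional calculus of the Hermitian matrix `ρ`. -/
def entropy {K : Type} [Fintype K] [DecidableEq K] (ρ : Matrix K K ℂ) : ℝ :=
  -(cfc (fun x : ℝ => x * Real.logb 2 x) ρ).trace.re

/-- Partial trace over the first factor. -/
def traceFst {K L : Type} [Fintype K] (ρ : Matrix (K × L) (K × L) ℂ) : Matrix L L ℂ :=
  Matrix.of fun l l' => ∑ k, ρ (k, l) (k, l')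

/-- Partial trace over the second factor. -/
def traceSnd {K L : Type} [Fintype L] (ρ : Matrix (K × L) (K × L) ℂ) : Matrix K K ℂ :=
  Matrix.of fun k k' => ∑ l, ρ (k, l) (k', l)

/-- Partial trace over the middle one of three factors. -/
def traceMid {K L M : Type} [Fintype L] (ρ : Matrix (K × L × M) (K × L × M) ℂ) :
    Matrix (K × M) (K × M) ℂ :=
  Matrix.of fun i j => ∑ l, ρ (i.1, l, i.2) (j.1, l, j.2)

/-- Partial trace over the last one of three factors. -/
def traceLast {K L M : Type} [Fintype M] (ρ : Matrix (K × L × M) (K × L × M) ℂ) :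
    Matrix (K × L) (K × L) ℂ :=
  Matrix.of fun i j => ∑ m, ρ (i.1, i.2, m) (j.1, j.2, m)

/-- For a state on the systems `C A B`, the mutual information
`I(CA; B) = H(CA) + H(B) - H(CAB)`. -/
def jointMutualInfo {C A B : Type} [Fintype C] [DecidableEq C] [Fintype A] [DecidableEq A]
    [Fintype B] [DecidableEq B] (ρ : Matrix (C × A × B) (C × A × B) ℂ) : ℝ :=
  entropy (traceLast ρ) + entropy (traceFst (traceFst ρ)) - entropy ρ

/-- For a state on the systems `C A B`, the conditional mutual information
`I(A; B | C) = H(CA) + H(CB) - H(C) - H(CAB)`. -/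
def condMutualInfo {C A B : Type} [Fintype C] [DecidableEq C] [Fintype A] [DecidableEq A]
    [Fintype B] [DecidableEq B] (ρ : Matrix (C × A × B) (C × A × B) ℂ) : ℝ :=
  entropy (traceLast ρ) + entropy (traceMid ρ) - entropy (traceSnd ρ) - entropy ρ

/-- `V : A → B ⊗ E` is an isometric extension of `N`: it is an isometry, and `N` is recovered
by tracing out the environment `E`. A linear map `N` has an isometric extension (for some
finite-dimensional `E`) iff it is a quantum channel, i.e. completely positive and trace
preserving. -/
def IsIsometricExtension {A B E : Type} [Fintype A] [DecidableEq A] [Fintype B] [Fintype E]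
    (N : Matrix A A ℂ →ₗ[ℂ] Matrix B B ℂ) (V : Matrix (B × E) A ℂ) : Prop :=
  Vᴴ * V = 1 ∧ ∀ ρ : Matrix A A ℂ, traceSnd (V * ρ * Vᴴ) = N ρ

/-- A finite ensemble `{p(x, y), ρ_{x,y}}` of (mixed) states on `A`, indexed by two classical
variables with arbitrary finite alphabets. -/
structure Ensemble (A : Type) [Fintype A] where
  cardX : ℕ
  cardY : ℕ
  prob : Fin cardX → Fin cardY → ℝ
  prob_nonneg : ∀ x y, 0 ≤ prob x y
  prob_sum : ∑ x, ∑ y, prob x y = 1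
  state : Fin cardX → Fin cardY → Matrix A A ℂ
  state_density : ∀ x y, IsDensity (state x y)

variable {A B E : Type} [Fintype A] [DecidableEq A] [Fintype B] [DecidableEq B]
  [Fintype E] [DecidableEq E]

/-- The classical-quantum state
`σ^{XYBE} = ∑ p(x, y) |x⟩⟨x| ⊗ |y⟩⟨y| ⊗ V ρ_{x,y} V†`. -/
def cqState (𝓔 : Ensemble A) (V : Matrix (B × E) A ℂ) :
    Matrix (Fin 𝓔.cardX × Fin 𝓔.cardY × B × E) (Fin 𝓔.cardX × Fin 𝓔.cardY × B × E) ℂ :=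
  ∑ x, ∑ y, (𝓔.prob x y : ℂ) •
    (Matrix.single x x (1 : ℂ) ⊗ₖ (Matrix.single y y (1 : ℂ) ⊗ₖ (V * 𝓔.state x y * Vᴴ)))

/-- The marginal `σ^{XYB}`. -/
def stateXYB (𝓔 : Ensemble A) (V : Matrix (B × E) A ℂ) :
    Matrix (Fin 𝓔.cardX × Fin 𝓔.cardY × B) (Fin 𝓔.cardX × Fin 𝓔.cardY × B) ℂ :=
  Matrix.of fun i j =>
    ∑ e, cqState 𝓔 V (i.1, i.2.1, i.2.2, e) (j.1, j.2.1, j.2.2, e)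

/-- The marginal `σ^{XYE}`. -/
def stateXYE (𝓔 : Ensemble A) (V : Matrix (B × E) A ℂ) :
    Matrix (Fin 𝓔.cardX × Fin 𝓔.cardY × E) (Fin 𝓔.cardX × Fin 𝓔.cardY × E) ℂ :=
  Matrix.of fun i j =>
    ∑ b, cqState 𝓔 V (i.1, i.2.1, b, i.2.2) (j.1, j.2.1, b, j.2.2)

/-- `I(YX; B)_σ`. -/
def infoYXB (𝓔 : Ensemble A) (V : Matrix (B × E) A ℂ) : ℝ := jointMutualInfo (stateXYB 𝓔 V)

/-- `I(Y; B | X)_σ`. -/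
def infoYBgivenX (𝓔 : Ensemble A) (V : Matrix (B × E) A ℂ) : ℝ := condMutualInfo (stateXYB 𝓔 V)

/-- `I(Y; E | X)_σ`. -/
def infoYEgivenX (𝓔 : Ensemble A) (V : Matrix (B × E) A ℂ) : ℝ := condMutualInfo (stateXYE 𝓔 V)

/-- The quantity that is maximized in the private dynamic capacity formula. -/
def objective (lam mu : ℝ) (𝓔 : Ensemble A) (V : Matrix (B × E) A ℂ) : ℝ :=
  infoYXB 𝓔 V + lam * (infoYBgivenX 𝓔 V - infoYEgivenX 𝓔 V)
    + mu * (infoYXB 𝓔 V - infoYEgivenX 𝓔 V)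

/-- All values of the objective over the states `σ^{XYBE}` that the channel `N` can produce. -/
def objectiveValues (N : Matrix A A ℂ →ₗ[ℂ] Matrix B B ℂ) (lam mu : ℝ) : Set ℝ :=
  {v | ∃ (𝓔 : Ensemble A) (d : ℕ) (V : Matrix (B × Fin d) A ℂ),
    IsIsometricExtension N V ∧ v = objective lam mu 𝓔 V}

/-- The private dynamic capacity formula `P_{λ,μ}(N)`. -/
def capacityFormula (N : Matrix A A ℂ →ₗ[ℂ] Matrix B B ℂ) (lam mu : ℝ) : ℝ :=
  sSup (objectiveValues N lam mu)

/-- The one-shot private dynamic capacity region: all rate triples `(R, P, S)` that satisfy the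
three bounds for some state `σ^{XYBE}`. -/
def oneShotRegion (N : Matrix A A ℂ →ₗ[ℂ] Matrix B B ℂ) : Set (ℝ × ℝ × ℝ) :=
  {r | ∃ (𝓔 : Ensemble A) (d : ℕ) (V : Matrix (B × Fin d) A ℂ), IsIsometricExtension N V ∧
    r.1 + r.2.1 ≤ infoYXB 𝓔 V ∧
    r.2.1 + r.2.2 ≤ infoYBgivenX 𝓔 V - infoYEgivenX 𝓔 V ∧
    r.1 + r.2.1 + r.2.2 ≤ infoYXB 𝓔 V - infoYEgivenX 𝓔 V}

/-- The tensor product `N ⊗ M` of two linear maps between matrix algebras. -/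
def tensorMap {A' B' : Type} [Fintype A'] [DecidableEq A']
    (N : Matrix A A ℂ →ₗ[ℂ] Matrix B B ℂ) (M : Matrix A' A' ℂ →ₗ[ℂ] Matrix B' B' ℂ) :
    Matrix (A × A') (A × A') ℂ →ₗ[ℂ] Matrix (B × B') (B × B') ℂ where
  toFun ρ := ∑ a, ∑ a', ∑ c, ∑ c', ρ (a, c) (a', c') •
    (N (Matrix.single a a' 1) ⊗ₖ M (Matrix.single c c' 1))
  map_add' ρ τ := by simp only [Matrix.add_apply, add_smul, Finset.sum_add_distrib]
  map_smul' z ρ := by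
    simp only [Matrix.smul_apply, smul_eq_mul, mul_smul, Finset.smul_sum, RingHom.id_apply]

/-- `tensorMap` is the tensor product: `(N ⊗ M)(ρ ⊗ τ) = N(ρ) ⊗ M(τ)`. -/
theorem tensorMap_kronecker {A' B' : Type} [Fintype A'] [DecidableEq A']
    (N : Matrix A A ℂ →ₗ[ℂ] Matrix B B ℂ) (M : Matrix A' A' ℂ →ₗ[ℂ] Matrix B' B' ℂ)
    (ρ : Matrix A A ℂ) (τ : Matrix A' A' ℂ) :
    tensorMap N M (ρ ⊗ₖ τ) = N ρ ⊗ₖ M τ := by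
  have h1 : N ρ = ∑ a, ∑ a', ρ a a' • N (Matrix.single a a' 1) := by
    conv_lhs => rw [Matrix.matrix_eq_sum_single ρ]
    rw [map_sum]
    refine Finset.sum_congr rfl fun a _ => ?_
    rw [map_sum]
    refine Finset.sum_congr rfl fun a' _ => ?_
    rw [← map_smul, Matrix.smul_single, smul_eq_mul, mul_one]
  have h2 : M τ = ∑ c, ∑ c', τ c c' • M (Matrix.single c c' 1) := by
    conv_lhs => rw [Matrix.matrix_eq_sum_single τ]
    rw [map_sum]
    refine Finset.sum_congr rfl fun c _ => ?_
    rw [map_sum]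
    refine Finset.sum_congr rfl fun c' _ => ?_
    rw [← map_smul, Matrix.smul_single, smul_eq_mul, mul_one]
  ext i j
  simp only [tensorMap, LinearMap.coe_mk, AddHom.coe_mk, Matrix.kroneckerMap_apply, h1, h2,
    Matrix.sum_apply, Matrix.smul_apply, smul_eq_mul, Finset.sum_mul]
  refine Finset.sum_congr rfl fun a _ => Finset.sum_congr rfl fun a' _ => ?_
  simp only [Finset.mul_sum]
  refine Finset.sum_congr rfl fun c _ => Finset.sum_congr rfl fun c' _ => ?_
  ring

/-- The qubit erasure channel `ρ ↦ (1 - ε) ρ + ε Tr(ρ) |e⟩⟨e|`. The output space has the basis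
`|0⟩, |1⟩` (`Sum.inl`) together with the erasure flag `|e⟩` (`Sum.inr`). -/
def erasureChannel (ε : ℝ) :
    Matrix (Fin 2) (Fin 2) ℂ →ₗ[ℂ] Matrix (Fin 2 ⊕ Unit) (Fin 2 ⊕ Unit) ℂ where
  toFun ρ := Matrix.fromBlocks ((1 - ε : ℂ) • ρ) 0 0 ((ε : ℂ) • Matrix.of fun _ _ => ρ.trace)
  map_add' ρ τ := by
    ext i j
    rcases i with i | i <;> rcases j with j | j <;> simp
  map_smul' z ρ := by
    ext i j
    rcases i with i | i <;> rcases j with j | j <;> simp [mul_left_comm]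

/-- The binary entropy `H₂(p) = -p log₂ p - (1 - p) log₂ (1 - p)`. -/
def binaryEntropy (p : ℝ) : ℝ := -(p * Real.logb 2 p) - (1 - p) * Real.logb 2 (1 - p)

end

end PrivateDynamic

namespace PrivateDynamic

set_option linter.unusedSectionVars false

/-! Write S(τ) = H(τ) - η(Tr τ) for the entropy made homogeneous of degree one on unnormalized
states (`scaledEntropy`). On a classical-quantum state the entropies of the classical labels are
absorbed by S, and each mutual information becomes a difference of two of three averages of S over
the subnormalized ensemble: at the total state, at the sum over y for each x, and at the individual
states (`jointMutualInfo_cqMatrix`, `condMutualInfo_cqMatrix`).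

An erasure channel outputs a direct sum, so S of its output is (1 - ε) S(τ) plus a multiple of Tr τ
(`scaledEntropy_erasureChannel`). That multiple cancels in every information. The complementary
channel is the erasure channel with parameter 1 - ε (`traceFst_erasureIsometry`), and the choice of
isometric extension is irrelevant (`scaledEntropy_traceFst_eq`). With h, a, b the three averages of
S, the informations are (1 - ε)(h - b), (1 - ε)(a - b) and ε(a - b). Here h - b ≤ 1, and a - b lies
in [0, 1] by concavity, so a - b = H₂(p) for some p. A uniform bit X added to a bit Y of bias p
attains h - b = 1 and a - b = H₂(p). This gives the region, and the maximum (1 - ε)(1 + μ) + max(0,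
c) with c = λ(1 - 2ε) - με.

For two copies the output splits into four erasure patterns, which brings in the entropies of the
two marginals (`scaledEntropy_tensorMap_erasureChannel`). Subadditivity compares these with the
joint entropy and bounds the objective by twice the single-copy value (`two_copy_objective_le`).
Uniform basis states, labelled by X if c ≤ 0 and by Y if c ≥ 0, attain the bound. -/

/-- The entropy function `η(x) = -x log₂ x`. -/
noncomputable def eta (x : ℝ) : ℝ := Real.negMulLog x / Real.log 2

lemma eta_eq (x : ℝ) : eta x = -(x * Real.logb 2 x) := by
  simp only [eta, Real.negMulLog, Real.logb]; ring

@[simp] lemma eta_zero : eta 0 = 0 := by simp [eta]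

@[simp] lemma eta_one : eta 1 = 0 := by simp [eta]

/-- This Leibniz rule is what makes all the weights and normalizations below separate from the
entropies. -/
lemma eta_mul (x y : ℝ) : eta (x * y) = y * eta x + x * eta y := by
  simp only [eta, Real.negMulLog_mul]; ring

lemma concaveOn_eta : ConcaveOn ℝ (Set.Ici 0) eta := by
  have h := Real.concaveOn_negMulLog.smul (inv_nonneg.2 (Real.log_nonneg one_le_two))
  refine h.congr fun x _ => ?_
  simp [eta, div_eq_inv_mul]

/-! ### Entropy as a function of the spectrum -/

section Spectral

variable {K L : Type} [Fintype K] [DecidableEq K] [Fintype L] [DecidableEq L]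

lemma entropy_eq_sum_eta_eigenvalues {A : Matrix K K ℂ} (hA : A.IsHermitian) :
    entropy A = ∑ i, eta (hA.eigenvalues i) := by
  rw [entropy, hA.cfc_eq, Matrix.IsHermitian.cfc, Unitary.conjStarAlgAut_apply,
    Matrix.trace_mul_comm, ← mul_assoc, Unitary.coe_star_mul_self, one_mul, Matrix.trace_diagonal]
  simp [eta_eq]

/-- The right side sees only the characteristic polynomial, so invariance and additivity of the
entropy reduce to polynomial identities, even between matrices with different index types. -/
lemma entropy_eq_sum_eta_roots {A : Matrix K K ℂ} (hA : A.IsHermitian) :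
    entropy A = (A.charpoly.roots.map fun z => eta z.re).sum := by
  rw [entropy_eq_sum_eta_eigenvalues hA, hA.roots_charpoly_eq_eigenvalues]
  simp

lemma entropy_eq_of_charpoly_eq {A : Matrix K K ℂ} {B : Matrix L L ℂ} (hA : A.IsHermitian)
    (hB : B.IsHermitian) (h : A.charpoly = B.charpoly) : entropy A = entropy B := by
  rw [entropy_eq_sum_eta_roots hA, entropy_eq_sum_eta_roots hB, h]

lemma entropy_reindex (e : K ≃ L) {A : Matrix K K ℂ} (hA : A.IsHermitian) :
    entropy (Matrix.reindex e e A) = entropy A :=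
  entropy_eq_of_charpoly_eq (hA.submatrix _) hA (Matrix.charpoly_reindex e A)

lemma entropy_diagonal (d : K → ℝ) :
    entropy (Matrix.diagonal fun i => (d i : ℂ)) = ∑ i, eta (d i) := by
  have hd : (Matrix.diagonal fun i => (d i : ℂ)).IsHermitian := by
    simp [Matrix.IsHermitian, Matrix.diagonal_conjTranspose, Pi.star_def]
  rw [entropy_eq_sum_eta_roots hd, Matrix.charpoly_diagonal, Polynomial.roots_prod]
  · simp
  · simp [Finset.prod_ne_zero_iff, Polynomial.X_sub_C_ne_zero]

lemma entropy_unitary_conj (U : Matrix.unitaryGroup K ℂ) {A : Matrix K K ℂ} (hA : A.IsHermitian) :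
    entropy (star (U : Matrix K K ℂ) * A * (U : Matrix K K ℂ)) = entropy A := by
  refine entropy_eq_of_charpoly_eq ?_ hA ?_
  · exact Matrix.isHermitian_conjTranspose_mul_mul _ hA
  · rw [Matrix.charpoly_mul_comm, ← mul_assoc, Unitary.mul_star_self_of_mem U.2, one_mul]

/-- The two characteristic polynomials agree up to powers of X; the extra zero eigenvalues
contribute η(0) = 0. -/
lemma entropy_mul_conjTranspose_comm (A : Matrix K L ℂ) : entropy (A * Aᴴ) = entropy (Aᴴ * A) := by
  have h := congrArg (fun p : Polynomial ℂ => (p.roots.map fun z => eta z.re).sum)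
    (Matrix.charpoly_mul_comm' A Aᴴ)
  rw [Polynomial.roots_mul, Polynomial.roots_mul, Polynomial.roots_X_pow,
    Polynomial.roots_X_pow] at h
  · rw [entropy_eq_sum_eta_roots (Matrix.isHermitian_mul_conjTranspose_self A),
      entropy_eq_sum_eta_roots (Matrix.isHermitian_conjTranspose_mul_self A)]
    simpa [Multiset.map_nsmul, Multiset.sum_nsmul] using h
  · exact mul_ne_zero (pow_ne_zero _ Polynomial.X_ne_zero) (Matrix.charpoly_monic _).ne_zero
  · exact mul_ne_zero (pow_ne_zero _ Polynomial.X_ne_zero) (Matrix.charpoly_monic _).ne_zero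

lemma entropy_fromBlocks_zero {A : Matrix K K ℂ} {B : Matrix L L ℂ} (hA : A.IsHermitian)
    (hB : B.IsHermitian) : entropy (Matrix.fromBlocks A 0 0 B) = entropy A + entropy B := by
  rw [entropy_eq_sum_eta_roots (hA.fromBlocks (by simp) hB), Matrix.charpoly_fromBlocks_zero₁₂,
    Polynomial.roots_mul (mul_ne_zero (Matrix.charpoly_monic _).ne_zero
      (Matrix.charpoly_monic _).ne_zero), Multiset.map_add, Multiset.sum_add,
    ← entropy_eq_sum_eta_roots hA, ← entropy_eq_sum_eta_roots hB]

lemma charpoly_blockDiagonal (M : L → Matrix K K ℂ) :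
    (Matrix.blockDiagonal M).charpoly = ∏ l, (M l).charpoly := by
  have h : (Matrix.blockDiagonal M).charmatrix =
      Matrix.blockDiagonal fun l => (M l).charmatrix := by
    ext1 ⟨i, k⟩ ⟨j, l⟩
    simp only [Matrix.charmatrix_apply, Matrix.blockDiagonal_apply, Matrix.diagonal_apply,
      Prod.mk.injEq]
    by_cases hk : k = l
    · subst hk; simp
    · simp [hk]
  simp [Matrix.charpoly, h]

lemma entropy_blockDiagonal {M : L → Matrix K K ℂ} (hM : ∀ l, (M l).IsHermitian) :
    entropy (Matrix.blockDiagonal M) = ∑ l, entropy (M l) := by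
  rw [entropy_eq_sum_eta_roots, charpoly_blockDiagonal, Polynomial.roots_prod]
  · simp [Multiset.map_bind, Multiset.sum_bind, entropy_eq_sum_eta_roots (hM _)]
  · exact Finset.prod_ne_zero_iff.2 fun l _ => (Matrix.charpoly_monic _).ne_zero
  · rw [Matrix.IsHermitian, Matrix.blockDiagonal_conjTranspose]
    exact congrArg _ (funext hM)

lemma eq_unitary_conj_diagonal {A : Matrix K K ℂ} (hA : A.IsHermitian) :
    star (hA.eigenvectorUnitary : Matrix K K ℂ) * A * (hA.eigenvectorUnitary : Matrix K K ℂ) =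
      Matrix.diagonal fun i => (hA.eigenvalues i : ℂ) := by
  have := hA.conjStarAlgAut_star_eigenvectorUnitary
  rwa [Unitary.conjStarAlgAut_star_apply] at this

lemma sum_eigenvalues_eq {A : Matrix K K ℂ} (hA : A.IsHermitian) :
    ∑ i, hA.eigenvalues i = A.trace.re := by
  rw [hA.trace_eq_sum_eigenvalues]; simp

lemma entropy_smul (c : ℝ) {A : Matrix K K ℂ} (hA : A.IsHermitian) :
    entropy ((c : ℂ) • A) = c * entropy A + A.trace.re * eta c := by
  have hcA : ((c : ℂ) • A).IsHermitian := by
    rw [Matrix.IsHermitian, Matrix.conjTranspose_smul, hA.eq]; simp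
  rw [← entropy_unitary_conj hA.eigenvectorUnitary hcA, Matrix.mul_smul, Matrix.smul_mul,
    eq_unitary_conj_diagonal hA, ← Matrix.diagonal_smul]
  have := entropy_diagonal fun i => c * hA.eigenvalues i
  simp only [Complex.ofReal_mul] at this
  rw [show (c : ℂ) • (fun i => (hA.eigenvalues i : ℂ)) = fun i => (c : ℂ) * hA.eigenvalues i from rfl,
    this, entropy_eq_sum_eta_eigenvalues hA, ← sum_eigenvalues_eq hA, Finset.mul_sum,
    Finset.sum_mul, ← Finset.sum_add_distrib]
  refine Finset.sum_congr rfl fun i _ => ?_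
  rw [eta_mul]; ring

/-- The diagonal of a positive semidefinite matrix has at least the entropy of the matrix. -/
lemma entropy_le_sum_eta_diag {A : Matrix K K ℂ} (hA : A.PosSemidef) :
    entropy A ≤ ∑ k, eta (A k k).re := by
  set U : Matrix K K ℂ := ↑(hA.1.eigenvectorUnitary) with hU
  have hUU : U * star U = 1 := Unitary.coe_mul_star_self _
  have hUU' : star U * U = 1 := Unitary.coe_star_mul_self _
  -- In an eigenbasis the diagonal entries are mixtures of the eigenvalues with the doubly
  -- stochastic weights |U k j|². Row sums allow Jensen's inequality for η, and column sums recover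
  -- the entropy.
  have hdiag : ∀ k, (A k k).re = ∑ j, Complex.normSq (U k j) • hA.1.eigenvalues j := by
    intro k
    have h := hA.1.spectral_theorem
    rw [Unitary.conjStarAlgAut_apply] at h
    have h2 := congrFun (congrFun h k) k
    rw [h2, Matrix.mul_apply, Complex.re_sum]
    refine Finset.sum_congr rfl fun j _ => ?_
    simp only [Matrix.mul_diagonal, Matrix.star_apply, ← hU, Function.comp_apply, smul_eq_mul,
      Complex.normSq_apply, Complex.mul_re, Complex.mul_im, RCLike.star_def, Complex.conj_re,
      Complex.conj_im, Complex.coe_algebraMap, Complex.ofReal_re, Complex.ofReal_im]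
    ring
  have hrow : ∀ k, ∑ j, Complex.normSq (U k j) = 1 := by
    intro k
    have h := congrArg Complex.re (congrFun (congrFun hUU k) k)
    rw [Matrix.mul_apply, Complex.re_sum, Matrix.one_apply_eq, Complex.one_re] at h
    rw [← h]
    refine Finset.sum_congr rfl fun j _ => ?_
    simp [Complex.normSq_apply]
  have hcol : ∀ j, ∑ k, Complex.normSq (U k j) = 1 := by
    intro j
    have h := congrArg Complex.re (congrFun (congrFun hUU' j) j)
    rw [Matrix.mul_apply, Complex.re_sum, Matrix.one_apply_eq, Complex.one_re] at h
    rw [← h]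
    refine Finset.sum_congr rfl fun j _ => ?_
    simp [Complex.normSq_apply]
  calc entropy A = ∑ j, ∑ k, Complex.normSq (U k j) * eta (hA.1.eigenvalues j) := by
        rw [entropy_eq_sum_eta_eigenvalues hA.1]
        refine Finset.sum_congr rfl fun j _ => ?_
        rw [← Finset.sum_mul, hcol, one_mul]
    _ = ∑ k, ∑ j, Complex.normSq (U k j) • eta (hA.1.eigenvalues j) := Finset.sum_comm
    _ ≤ ∑ k, eta (A k k).re := by
        refine Finset.sum_le_sum fun k _ => ?_
        rw [hdiag k]
        exact concaveOn_eta.le_map_sum (fun _ _ => Complex.normSq_nonneg _) (hrow k)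
          fun j _ => hA.eigenvalues_nonneg j

end Spectral

/-! ### Inequalities for Shannon entropy without normalization -/

section Classical

variable {K L : Type} [Fintype K] [Fintype L]

lemma eta_sum_le {x : K → ℝ} (hx : ∀ k, 0 ≤ x k) : eta (∑ k, x k) ≤ ∑ k, eta (x k) := by
  simp only [eta_eq, Finset.sum_neg_distrib, neg_le_neg_iff, Finset.sum_mul]
  refine Finset.sum_le_sum fun k _ => ?_
  rcases (hx k).eq_or_lt with h | h
  · simp [← h]
  · refine mul_le_mul_of_nonneg_left ?_ h.le
    exact Real.logb_le_logb_of_le one_lt_two h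
      (Finset.single_le_sum (fun i _ => hx i) (Finset.mem_univ k))

/-- Subadditivity of the Shannon entropy, for unnormalized joint distributions. -/
lemma sum_eta_add_eta_le {q : K → L → ℝ} (hq : ∀ k l, 0 ≤ q k l) :
    ∑ k, ∑ l, eta (q k l) + eta (∑ k, ∑ l, q k l) ≤
      ∑ k, eta (∑ l, q k l) + ∑ l, eta (∑ k, q k l) := by
  set r : K → ℝ := fun k => ∑ l, q k l with hr
  set c : L → ℝ := fun l => ∑ k, q k l with hc
  set t : ℝ := ∑ k, r k with ht
  have hct : ∑ l, c l = t := Finset.sum_comm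
  have hqr : ∀ k l, q k l ≤ r k := fun k l =>
    Finset.single_le_sum (fun i _ => hq k i) (Finset.mem_univ l)
  have hqc : ∀ k l, q k l ≤ c l := fun k l =>
    Finset.single_le_sum (f := fun k => q k l) (fun i _ => hq i l) (Finset.mem_univ k)
  have hr0 : ∀ k, 0 ≤ r k := fun k => Finset.sum_nonneg fun l _ => hq k l
  have hc0 : ∀ l, 0 ≤ c l := fun l => Finset.sum_nonneg fun k _ => hq k l
  have hrt : ∀ k, r k ≤ t := fun k => Finset.single_le_sum (fun i _ => hr0 i) (Finset.mem_univ k)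
  -- This is log x ≤ x - 1 at x = r c / (t q), multiplied by q: the termwise form of the
  -- nonnegativity of the relative entropy between q and the product of its marginals.
  have key : ∀ k l, q k l - r k * c l / t ≤
      q k l * Real.log (q k l) + q k l * Real.log t - q k l * Real.log (r k)
        - q k l * Real.log (c l) := by
    intro k l
    rcases (hq k l).eq_or_lt with h | h
    · simp only [← h, zero_mul, sub_zero, add_zero, zero_sub, neg_nonpos]
      exact div_nonneg (mul_nonneg (hr0 k) (hc0 l)) ((hr0 k).trans (hrt k))
    · have h1 := h.trans_le (hqr k l)
      have h2 := h.trans_le (hqc k l)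
      have h3 := h1.trans_le (hrt k)
      have h4 := Real.log_le_sub_one_of_pos (x := r k * c l / t / q k l) (by positivity)
      rw [Real.log_div (by positivity) h.ne', Real.log_div (by positivity) h3.ne',
        Real.log_mul h1.ne' h2.ne'] at h4
      have h5 := mul_le_mul_of_nonneg_left h4 h.le
      have h6 : q k l * (r k * c l / t / q k l - 1) = r k * c l / t - q k l := by
        field_simp
      linarith
  -- The product r c / t has the same total mass as q. For t = 0 this relies on division by zero
  -- being zero.
  have hsum : ∑ k, ∑ l, (q k l - r k * c l / t) = 0 := by
    simp only [Finset.sum_sub_distrib, ← Finset.sum_div, ← Finset.mul_sum, hct]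
    rw [← Finset.sum_mul]
    change t - t * t / t = 0
    rcases eq_or_ne t 0 with h | h
    · simp [h]
    · field_simp; simp
  have hle := Finset.sum_le_sum fun k (_ : k ∈ Finset.univ) =>
    Finset.sum_le_sum fun l (_ : l ∈ Finset.univ) => key k l
  rw [hsum] at hle
  have e1 : ∑ k, ∑ l, q k l * Real.log t = t * Real.log t := by
    simp only [← Finset.sum_mul]; rfl
  have e2 : ∑ k, ∑ l, q k l * Real.log (r k) = ∑ k, r k * Real.log (r k) := by
    simp only [← Finset.sum_mul]; rfl
  have e3 : ∑ k, ∑ l, q k l * Real.log (c l) = ∑ l, c l * Real.log (c l) := by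
    rw [Finset.sum_comm]; simp only [← Finset.sum_mul]; rfl
  simp only [Finset.sum_sub_distrib, Finset.sum_add_distrib, e1, e2, e3] at hle
  have hlog : 0 < Real.log 2 := Real.log_pos one_lt_two
  simp only [eta, ← Finset.sum_div, ← add_div]
  refine div_le_div_of_nonneg_right ?_ hlog.le
  simp only [Real.negMulLog, neg_mul, Finset.sum_neg_distrib]
  linarith

/-- Jensen's inequality for η with uniform weights. -/
lemma sum_eta_le_card [Nonempty K] {x : K → ℝ} (hx : ∀ k, 0 ≤ x k) :
    ∑ k, eta (x k) ≤ eta (∑ k, x k) + (∑ k, x k) * Real.logb 2 (Fintype.card K) := by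
  have hn : (0 : ℝ) < Fintype.card K := by exact_mod_cast Fintype.card_pos
  have h := concaveOn_eta.le_map_sum (t := Finset.univ) (w := fun _ : K => (Fintype.card K : ℝ)⁻¹)
    (p := x) (fun _ _ => by positivity) (by simp [hn.ne']) (fun k _ => hx k)
  simp only [smul_eq_mul, ← Finset.mul_sum] at h
  rw [eta_mul, eta_eq (Fintype.card K : ℝ)⁻¹, Real.logb_inv] at h
  have h2 := mul_le_mul_of_nonneg_left h hn.le
  rw [mul_inv_cancel_left₀ hn.ne'] at h2
  refine h2.trans_eq ?_
  field_simp
  ring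

end Classical

/-! ### The homogeneous entropy: bounds, concavity, subadditivity -/

section ScaledEntropy

variable {K L ι : Type} [Fintype K] [DecidableEq K] [Fintype L] [DecidableEq L] [Fintype ι]

/-- The positively homogeneous extension of the von Neumann entropy to unnormalized states. -/
noncomputable def scaledEntropy (A : Matrix K K ℂ) : ℝ := entropy A - eta A.trace.re

/-- The term Tr A · η(c) from scaling the entropy cancels against the same term from η(c Tr A). -/
lemma scaledEntropy_smul (c : ℝ) {A : Matrix K K ℂ} (hA : A.IsHermitian) :
    scaledEntropy ((c : ℂ) • A) = c * scaledEntropy A := by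
  simp only [scaledEntropy, entropy_smul c hA, Matrix.trace_smul, smul_eq_mul,
    Complex.re_ofReal_mul, eta_mul]
  ring

lemma scaledEntropy_reindex (e : K ≃ L) {A : Matrix K K ℂ} (hA : A.IsHermitian) :
    scaledEntropy (Matrix.reindex e e A) = scaledEntropy A := by
  rw [scaledEntropy, scaledEntropy, entropy_reindex e hA]
  congr 3
  exact Fintype.sum_equiv e.symm _ _ fun i => rfl

lemma scaledEntropy_nonneg {A : Matrix K K ℂ} (hA : A.PosSemidef) : 0 ≤ scaledEntropy A := by
  rw [scaledEntropy, entropy_eq_sum_eta_eigenvalues hA.1, ← sum_eigenvalues_eq hA.1]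
  exact sub_nonneg.2 (eta_sum_le hA.eigenvalues_nonneg)

lemma scaledEntropy_le [Nonempty K] {A : Matrix K K ℂ} (hA : A.PosSemidef) :
    scaledEntropy A ≤ A.trace.re * Real.logb 2 (Fintype.card K) := by
  rw [scaledEntropy, entropy_eq_sum_eta_eigenvalues hA.1, ← sum_eigenvalues_eq hA.1]
  linarith [sum_eta_le_card hA.eigenvalues_nonneg]

lemma diag_re_nonneg {A : Matrix K K ℂ} (hA : A.PosSemidef) (k : K) : 0 ≤ (A k k).re :=
  (Complex.le_def.1 (hA.diag_nonneg (i := k))).1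

/-- Concavity of the von Neumann entropy. -/
lemma sum_scaledEntropy_le {A : ι → Matrix K K ℂ} (hA : ∀ i, (A i).PosSemidef) :
    ∑ i, scaledEntropy (A i) ≤ scaledEntropy (∑ i, A i) := by
  have hS : (∑ i, A i).PosSemidef := Matrix.posSemidef_sum _ fun i _ => hA i
  -- In an eigenbasis of the sum, the diagonals of the summands form a joint distribution on pairs
  -- (i, k) whose marginals are the traces and the eigenvalues of the sum. Passing to diagonals only
  -- raises the entropy of each summand, and classical subadditivity finishes.
  set U := hS.1.eigenvectorUnitary with hU
  set B : ι → Matrix K K ℂ := fun i => star (U : Matrix K K ℂ) * A i * (U : Matrix K K ℂ) with hB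
  have hBpos : ∀ i, (B i).PosSemidef := fun i => (hA i).conjTranspose_mul_mul_same _
  have h1 : ∀ i, entropy (A i) ≤ ∑ k, eta ((B i) k k).re := fun i => by
    rw [← entropy_unitary_conj U (hA i).1]
    exact entropy_le_sum_eta_diag (hBpos i)
  have htr : ∀ i, ∑ k, ((B i) k k).re = (A i).trace.re := fun i => by
    rw [← Complex.re_sum]
    change (B i).trace.re = _
    rw [hB, Matrix.trace_mul_comm, ← mul_assoc, Unitary.mul_star_self_of_mem U.2, one_mul]
  have hev : ∀ k, ∑ i, ((B i) k k).re = hS.1.eigenvalues k := fun k => by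
    have h := congrFun (congrFun (eq_unitary_conj_diagonal hS.1) k) k
    rw [Matrix.diagonal_apply_eq, ← hU, Finset.mul_sum, Finset.sum_mul, Matrix.sum_apply] at h
    rw [← Complex.re_sum, h, Complex.ofReal_re]
  have h2 := sum_eta_add_eta_le (q := fun i k => ((B i) k k).re) fun i k =>
    diag_re_nonneg (hBpos i) k
  simp only [htr, hev] at h2
  simp only [scaledEntropy, Finset.sum_sub_distrib, entropy_eq_sum_eta_eigenvalues hS.1,
    Matrix.trace_sum, Complex.re_sum]
  linarith [Finset.sum_le_sum fun i (_ : i ∈ Finset.univ) => h1 i]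

/-- The rotation of the discarded factor disappears from the marginal. Thus a product of local
eigenbases diagonalizes both marginals at once, as subadditivity requires. -/
lemma traceSnd_kronecker_conj (A : Matrix (K × L) (K × L) ℂ) (U : Matrix K K ℂ)
    {V : Matrix L L ℂ} (hV : V * star V = 1) :
    traceSnd (star (U ⊗ₖ V) * A * (U ⊗ₖ V)) = star U * traceSnd A * U := by
  have hV' : ∀ l l', ∑ j, V l j * star (V l' j) = if l = l' then 1 else 0 := fun l l' => by
    rw [← Matrix.one_apply, ← hV, Matrix.mul_apply]; rfl
  ext k k'
  simp only [traceSnd, Matrix.of_apply, Matrix.mul_apply, Matrix.star_apply,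
    Matrix.kroneckerMap_apply, Fintype.sum_prod_type, Finset.sum_mul, star_mul', Finset.mul_sum]
  calc _ = ∑ a, ∑ b, ∑ c, ∑ d, star (U c k) * A (c, d) (a, b) * U a k' *
            ∑ j, V b j * star (V d j) := by
        simp only [Finset.mul_sum]
        rw [Finset.sum_comm]
        refine Finset.sum_congr rfl fun a _ => ?_
        rw [Finset.sum_comm]
        refine Finset.sum_congr rfl fun b _ => ?_
        rw [Finset.sum_comm]
        refine Finset.sum_congr rfl fun c _ => ?_
        rw [Finset.sum_comm]
        refine Finset.sum_congr rfl fun d _ => Finset.sum_congr rfl fun j _ => ?_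
        ring
    _ = _ := by
        simp only [hV']
        refine Finset.sum_congr rfl fun a _ => ?_
        rw [Finset.sum_comm]
        refine Finset.sum_congr rfl fun c _ => ?_
        simp

lemma traceFst_kronecker_conj (A : Matrix (K × L) (K × L) ℂ) {U : Matrix K K ℂ}
    (V : Matrix L L ℂ) (hU : U * star U = 1) :
    traceFst (star (U ⊗ₖ V) * A * (U ⊗ₖ V)) = star V * traceFst A * V := by
  have h := traceSnd_kronecker_conj (A.submatrix Prod.swap Prod.swap) V hU
  have e1 : ∀ M : Matrix (K × L) (K × L) ℂ,
    traceSnd (M.submatrix Prod.swap Prod.swap) = traceFst M := fun M => rfl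
  rw [e1] at h
  rw [← h, ← e1]
  congr 1
  have e2 : V ⊗ₖ U = (U ⊗ₖ V).submatrix (Equiv.prodComm L K) (Equiv.prodComm L K) := by
    ext i j; simp [mul_comm]
  have e3 : (Prod.swap : L × K → K × L) = Equiv.prodComm L K := rfl
  rw [e2, e3, Matrix.star_eq_conjTranspose, Matrix.star_eq_conjTranspose,
    Matrix.conjTranspose_submatrix, Matrix.submatrix_mul_equiv, Matrix.submatrix_mul_equiv]

lemma traceSnd_isHermitian {A : Matrix (K × L) (K × L) ℂ} (hA : A.IsHermitian) :
    (traceSnd A).IsHermitian := by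
  ext k k'
  simp only [traceSnd, Matrix.conjTranspose_apply, Matrix.of_apply, star_sum]
  exact Finset.sum_congr rfl fun l _ => hA.apply _ _

lemma traceFst_isHermitian {A : Matrix (K × L) (K × L) ℂ} (hA : A.IsHermitian) :
    (traceFst A).IsHermitian := by
  ext k k'
  simp only [traceFst, Matrix.conjTranspose_apply, Matrix.of_apply, star_sum]
  exact Finset.sum_congr rfl fun l _ => hA.apply _ _

lemma trace_traceSnd (A : Matrix (K × L) (K × L) ℂ) : (traceSnd A).trace = A.trace := by
  simp [traceSnd, Matrix.trace, Fintype.sum_prod_type]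

lemma trace_traceFst (A : Matrix (K × L) (K × L) ℂ) : (traceFst A).trace = A.trace := by
  simp only [traceFst, Matrix.trace, Fintype.sum_prod_type, Matrix.diag_apply, Matrix.of_apply]
  exact Finset.sum_comm

/-- Subadditivity of the von Neumann entropy. -/
lemma scaledEntropy_le_add {A : Matrix (K × L) (K × L) ℂ} (hA : A.PosSemidef) :
    scaledEntropy A ≤ scaledEntropy (traceSnd A) + scaledEntropy (traceFst A) := by
  have h1 := traceSnd_isHermitian hA.1
  have h2 := traceFst_isHermitian hA.1
  set U := h1.eigenvectorUnitary with hU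
  set V := h2.eigenvectorUnitary with hV
  -- In the product of the eigenbases of the marginals, the diagonal of the state is a classical
  -- joint distribution whose marginals are the two spectra.
  have hW : (U : Matrix K K ℂ) ⊗ₖ (V : Matrix L L ℂ) ∈ Matrix.unitaryGroup (K × L) ℂ :=
    Matrix.kronecker_mem_unitary U.2 V.2
  set W : Matrix (K × L) (K × L) ℂ := (U : Matrix K K ℂ) ⊗ₖ (V : Matrix L L ℂ) with hWdef
  set B := star W * A * W with hB
  have hBpos : B.PosSemidef := hA.conjTranspose_mul_mul_same _
  have hent : entropy A ≤ ∑ k, ∑ l, eta (B (k, l) (k, l)).re := by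
    rw [← entropy_unitary_conj ⟨W, hW⟩ hA.1, ← Fintype.sum_prod_type']
    exact entropy_le_sum_eta_diag hBpos
  have hr : ∀ k, ∑ l, (B (k, l) (k, l)).re = h1.eigenvalues k := fun k => by
    have h := congrFun (congrFun (eq_unitary_conj_diagonal h1) k) k
    rw [← traceSnd_kronecker_conj A _ (Unitary.mul_star_self_of_mem V.2),
      Matrix.diagonal_apply_eq] at h
    rw [← Complex.re_sum]
    exact (congrArg Complex.re h).trans (Complex.ofReal_re _)
  have hc : ∀ l, ∑ k, (B (k, l) (k, l)).re = h2.eigenvalues l := fun l => by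
    have h := congrFun (congrFun (eq_unitary_conj_diagonal h2) l) l
    rw [← traceFst_kronecker_conj A _ (Unitary.mul_star_self_of_mem U.2),
      Matrix.diagonal_apply_eq] at h
    rw [← Complex.re_sum]
    exact (congrArg Complex.re h).trans (Complex.ofReal_re _)
  have h3 := sum_eta_add_eta_le (q := fun k l => (B (k, l) (k, l)).re) fun k l =>
    diag_re_nonneg hBpos _
  simp only [hr, hc] at h3
  rw [sum_eigenvalues_eq, trace_traceSnd] at h3
  simp only [scaledEntropy, trace_traceSnd, trace_traceFst, entropy_eq_sum_eta_eigenvalues h1,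
    entropy_eq_sum_eta_eigenvalues h2]
  linarith

lemma scaledEntropy_diagonal (d : K → ℝ) :
    scaledEntropy (Matrix.diagonal fun i => (d i : ℂ)) = ∑ i, eta (d i) - eta (∑ i, d i) := by
  simp [scaledEntropy, entropy_diagonal, Matrix.trace_diagonal]

end ScaledEntropy

/-! ### Mutual informations of classical-quantum states -/

section ClassicalQuantum

variable {X Y K : Type} [Fintype X] [DecidableEq X] [Fintype Y] [DecidableEq Y]
  [Fintype K] [DecidableEq K]

/-- The classical-quantum matrix `∑ |x⟩⟨x| ⊗ |y⟩⟨y| ⊗ M x y`. -/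
def cqMatrix (M : X → Y → Matrix K K ℂ) : Matrix (X × Y × K) (X × Y × K) ℂ :=
  Matrix.of fun i j => if i.1 = j.1 ∧ i.2.1 = j.2.1 then M i.1 i.2.1 i.2.2 j.2.2 else 0

lemma trace_eq_ofReal_re {A : Matrix K K ℂ} (hA : A.PosSemidef) : A.trace = (A.trace.re : ℂ) :=
  (Complex.eq_re_of_ofReal_le (r := 0) (by simpa using hA.trace_nonneg))

lemma entropy_cqMatrix {M : X → Y → Matrix K K ℂ} (hM : ∀ x y, (M x y).PosSemidef) :
    entropy (cqMatrix M) = ∑ x, ∑ y, entropy (M x y) := by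
  let e : K × (X × Y) ≃ X × Y × K :=
    (Equiv.prodComm K (X × Y)).trans (Equiv.prodAssoc X Y K)
  have h : cqMatrix M = Matrix.reindex e e (Matrix.blockDiagonal fun z : X × Y => M z.1 z.2) := by
    ext ⟨x, y, k⟩ ⟨x', y', k'⟩
    simp [cqMatrix, e, Matrix.blockDiagonal_apply]
  have hH : (Matrix.blockDiagonal fun z : X × Y => M z.1 z.2).IsHermitian := by
    rw [Matrix.IsHermitian, Matrix.blockDiagonal_conjTranspose]
    exact congrArg _ (funext fun z => (hM z.1 z.2).1)
  rw [h, entropy_reindex e hH, entropy_blockDiagonal (M := fun z : X × Y => M z.1 z.2) fun z => (hM z.1 z.2).1,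
    Fintype.sum_prod_type]

lemma entropy_traceLast_cqMatrix {M : X → Y → Matrix K K ℂ} (hM : ∀ x y, (M x y).PosSemidef) :
    entropy (traceLast (cqMatrix M)) = ∑ x, ∑ y, eta (M x y).trace.re := by
  have h : traceLast (cqMatrix M) =
      Matrix.diagonal fun z : X × Y => (((M z.1 z.2).trace.re : ℝ) : ℂ) := by
    simp only [← trace_eq_ofReal_re (hM _ _)]
    ext ⟨x, y⟩ ⟨x', y'⟩
    by_cases hx : x = x' ∧ y = y'
    · obtain ⟨rfl, rfl⟩ := hx
      simp [traceLast, cqMatrix, Matrix.trace]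
    · rw [Matrix.diagonal_apply_ne _ (by simpa using hx)]
      simp [traceLast, cqMatrix, hx]
  rw [h, entropy_diagonal, Fintype.sum_prod_type]

lemma entropy_traceSnd_cqMatrix {M : X → Y → Matrix K K ℂ} (hM : ∀ x y, (M x y).PosSemidef) :
    entropy (traceSnd (cqMatrix M)) = ∑ x, eta (∑ y, M x y).trace.re := by
  have hS : ∀ x, (∑ y, M x y).PosSemidef := fun x => Matrix.posSemidef_sum _ fun y _ => hM x y
  have h : traceSnd (cqMatrix M) =
      Matrix.diagonal fun x => (((∑ y, M x y).trace.re : ℝ) : ℂ) := by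
    simp only [← trace_eq_ofReal_re (hS _)]
    ext x x'
    by_cases hx : x = x'
    · subst hx
      simp only [traceSnd, cqMatrix, Matrix.sum_apply, Fintype.sum_prod_type, Matrix.trace,
        Matrix.of_apply, Matrix.diagonal_apply_eq, Matrix.diag_apply, and_self, if_true]
      exact Finset.sum_comm
    · simp [traceSnd, cqMatrix, hx]
  rw [h, entropy_diagonal]

lemma entropy_traceMid_cqMatrix {M : X → Y → Matrix K K ℂ} (hM : ∀ x y, (M x y).PosSemidef) :
    entropy (traceMid (cqMatrix M)) = ∑ x, entropy (∑ y, M x y) := by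
  have hS : ∀ x, (∑ y, M x y).PosSemidef := fun x => Matrix.posSemidef_sum _ fun y _ => hM x y
  have h : traceMid (cqMatrix M) = Matrix.reindex (Equiv.prodComm K X) (Equiv.prodComm K X)
      (Matrix.blockDiagonal fun x => ∑ y, M x y) := by
    ext ⟨x, k⟩ ⟨x', k'⟩
    by_cases hx : x = x'
    · subst hx
      simp [traceMid, cqMatrix, Matrix.blockDiagonal_apply, Matrix.sum_apply]
    · simp [traceMid, cqMatrix, Matrix.blockDiagonal_apply, hx]
  have hH : (Matrix.blockDiagonal fun x => ∑ y, M x y).IsHermitian := by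
    rw [Matrix.IsHermitian, Matrix.blockDiagonal_conjTranspose]
    exact congrArg _ (funext fun x => (hS x).1)
  rw [h, entropy_reindex _ hH, entropy_blockDiagonal fun x => (hS x).1]

lemma traceFst_traceFst_cqMatrix (M : X → Y → Matrix K K ℂ) :
    traceFst (traceFst (cqMatrix M)) = ∑ x, ∑ y, M x y := by
  ext k k'
  simp only [traceFst, cqMatrix, Matrix.of_apply, Matrix.sum_apply, and_self, if_true]
  exact Finset.sum_comm

/-- The entropy of the labels is the sum of the η(Tr M x y), exactly the corrections contained in
`scaledEntropy`; for the total state the correction is η(1) = 0. -/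
lemma jointMutualInfo_cqMatrix {M : X → Y → Matrix K K ℂ} (hM : ∀ x y, (M x y).PosSemidef)
    (htr : (∑ x, ∑ y, M x y).trace = 1) :
    jointMutualInfo (cqMatrix M) =
      scaledEntropy (∑ x, ∑ y, M x y) - ∑ x, ∑ y, scaledEntropy (M x y) := by
  simp only [jointMutualInfo, entropy_cqMatrix hM, entropy_traceLast_cqMatrix hM,
    traceFst_traceFst_cqMatrix, scaledEntropy, htr, Finset.sum_sub_distrib, Complex.one_re,
    eta_one]
  ring

/-- Normalization plays no role here, because the label entropies H(X) and H(XY) both occur and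
supply every correction term. -/
lemma condMutualInfo_cqMatrix {M : X → Y → Matrix K K ℂ} (hM : ∀ x y, (M x y).PosSemidef) :
    condMutualInfo (cqMatrix M) =
      ∑ x, scaledEntropy (∑ y, M x y) - ∑ x, ∑ y, scaledEntropy (M x y) := by
  simp only [condMutualInfo, entropy_cqMatrix hM, entropy_traceLast_cqMatrix hM,
    entropy_traceMid_cqMatrix hM, entropy_traceSnd_cqMatrix hM, scaledEntropy,
    Finset.sum_sub_distrib]
  ring

end ClassicalQuantum

/-! ### Informations in terms of a channel and its complement -/

section Isometry

variable {A B E E' : Type} [Fintype A] [DecidableEq A] [Fintype B] [DecidableEq B]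
  [Fintype E] [DecidableEq E] [Fintype E'] [DecidableEq E']

/-- The subnormalized state `p(x, y) ρ_{x,y}`. -/
noncomputable def Ensemble.weighted (𝓔 : Ensemble A) (x : Fin 𝓔.cardX) (y : Fin 𝓔.cardY) :
    Matrix A A ℂ := (𝓔.prob x y : ℂ) • 𝓔.state x y

lemma Ensemble.weighted_posSemidef (𝓔 : Ensemble A) (x y) : (𝓔.weighted x y).PosSemidef :=
  (𝓔.state_density x y).1.smul (by simpa using 𝓔.prob_nonneg x y)

lemma Ensemble.trace_weighted (𝓔 : Ensemble A) (x y) :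
    (𝓔.weighted x y).trace = 𝓔.prob x y := by
  simp [Ensemble.weighted, Matrix.trace_smul, (𝓔.state_density x y).2]

lemma Ensemble.trace_sum_weighted (𝓔 : Ensemble A) :
    (∑ x, ∑ y, 𝓔.weighted x y).trace = 1 := by
  simp only [Matrix.trace_sum, Ensemble.trace_weighted]
  exact_mod_cast congrArg (fun r : ℝ => (r : ℂ)) 𝓔.prob_sum

lemma cqState_apply (𝓔 : Ensemble A) (V : Matrix (B × E) A ℂ) (x x' y y' b b' e e') :
    cqState 𝓔 V (x, y, b, e) (x', y', b', e') =
      if x = x' ∧ y = y' then (V * 𝓔.weighted x y * Vᴴ) (b, e) (b', e') else 0 := by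
  simp only [cqState, Matrix.sum_apply, Matrix.smul_apply, Matrix.kroneckerMap_apply,
    Matrix.single_apply, Ensemble.weighted, Matrix.mul_smul, Matrix.smul_mul]
  rw [Finset.sum_eq_single x (fun z _ hz => by simp [hz]) (by simp),
    Finset.sum_eq_single y (fun z _ hz => by simp [hz]) (by simp)]
  by_cases hx : x = x' <;> by_cases hy : y = y' <;> simp [hx, hy]

lemma stateXYB_eq (𝓔 : Ensemble A) (V : Matrix (B × E) A ℂ) :
    stateXYB 𝓔 V = cqMatrix fun x y => traceSnd (V * 𝓔.weighted x y * Vᴴ) := by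
  ext ⟨x, y, b⟩ ⟨x', y', b'⟩
  by_cases h : x = x' ∧ y = y' <;> simp [stateXYB, cqMatrix, cqState_apply, traceSnd, h]

lemma stateXYE_eq (𝓔 : Ensemble A) (V : Matrix (B × E) A ℂ) :
    stateXYE 𝓔 V = cqMatrix fun x y => traceFst (V * 𝓔.weighted x y * Vᴴ) := by
  ext ⟨x, y, b⟩ ⟨x', y', b'⟩
  by_cases h : x = x' ∧ y = y' <;> simp [stateXYE, cqMatrix, cqState_apply, traceFst, h]

lemma traceSnd_posSemidef {M : Matrix (B × E) (B × E) ℂ} (hM : M.PosSemidef) :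
    (traceSnd M).PosSemidef := by
  have h : traceSnd M = ∑ e, M.submatrix (fun b => (b, e)) (fun b => (b, e)) := by
    ext b b'; simp [traceSnd, Matrix.sum_apply]
  rw [h]
  exact Matrix.posSemidef_sum _ fun e _ => hM.submatrix _

lemma traceFst_posSemidef {M : Matrix (B × E) (B × E) ℂ} (hM : M.PosSemidef) :
    (traceFst M).PosSemidef := by
  have h : traceFst M = ∑ b, M.submatrix (fun e => (b, e)) (fun e => (b, e)) := by
    ext b b'; simp [traceFst, Matrix.sum_apply]
  rw [h]
  exact Matrix.posSemidef_sum _ fun e _ => hM.submatrix _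

lemma trace_isometry_conj {V : Matrix (B × E) A ℂ} (hV : Vᴴ * V = 1) (ρ : Matrix A A ℂ) :
    (V * ρ * Vᴴ).trace = ρ.trace := by
  rw [Matrix.trace_mul_comm, ← Matrix.mul_assoc, hV, one_mul]

open scoped MatrixOrder in
lemma exists_eq_conjTranspose_mul_self {ρ : Matrix A A ℂ} (hρ : ρ.PosSemidef) :
    ∃ S : Matrix A A ℂ, ρ = Sᴴ * S :=
  CStarAlgebra.nonneg_iff_eq_star_mul_self.1 hρ.nonneg

/-- The output entropy of the environment does not depend on the isometric extension. -/
lemma scaledEntropy_traceFst_eq {N : Matrix A A ℂ →ₗ[ℂ] Matrix B B ℂ} {V : Matrix (B × E) A ℂ}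
    {W : Matrix (B × E') A ℂ} (hV : IsIsometricExtension N V) (hW : IsIsometricExtension N W)
    {ρ : Matrix A A ℂ} (hρ : ρ.PosSemidef) :
    scaledEntropy (traceFst (V * ρ * Vᴴ)) = scaledEntropy (traceFst (W * ρ * Wᴴ)) := by
  obtain ⟨S, rfl⟩ := exists_eq_conjTranspose_mul_self hρ
  -- With ρ = Sᴴ S, the matrix T Sᴴ purifies the output; `gram` regroups it as a matrix G from the
  -- output and the reference to the environment, so the environment state is G Gᴴ.
  let gram (F : Type) (T : Matrix (B × F) A ℂ) : Matrix F (B × A) ℂ :=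
    Matrix.of fun e i => (T * Sᴴ) (i.1, e) i.2
  have h1 : ∀ (F : Type) [Fintype F] [DecidableEq F] (T : Matrix (B × F) A ℂ),
      traceFst (T * (Sᴴ * S) * Tᴴ) = gram F T * (gram F T)ᴴ := by
    intro F _ _ T
    have h : T * (Sᴴ * S) * Tᴴ = (T * Sᴴ) * (T * Sᴴ)ᴴ := by
      simp [Matrix.conjTranspose_mul, Matrix.mul_assoc]
    rw [h]
    ext e e'
    simp only [traceFst, gram, Matrix.of_apply, Fintype.sum_prod_type,
      Matrix.mul_apply (M := T * Sᴴ), Matrix.mul_apply (M := Matrix.of _),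
      Matrix.conjTranspose_apply]
  -- The opposite product Gᴴ G involves `N` alone. Since G Gᴴ and Gᴴ G have equal entropy, the
  -- environment entropy is the same for all extensions.
  have h2 : ∀ (F : Type) [Fintype F] [DecidableEq F] (T : Matrix (B × F) A ℂ),
      IsIsometricExtension N T → (gram F T)ᴴ * gram F T = Matrix.of fun i j =>
        N (Sᴴ * Matrix.single j.2 i.2 (1 : ℂ) * S) j.1 i.1 := by
    intro F _ _ T hT
    ext ⟨b, a⟩ ⟨b', a'⟩
    have h : T * (Sᴴ * Matrix.single a' a (1 : ℂ) * S) * Tᴴ =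
        (T * Sᴴ) * Matrix.single a' a (1 : ℂ) * (T * Sᴴ)ᴴ := by
      simp [Matrix.conjTranspose_mul, Matrix.mul_assoc]
    rw [Matrix.of_apply, ← hT.2, h]
    simp only [Matrix.mul_apply (M := (gram F T)ᴴ), traceSnd, Matrix.of_apply, gram,
      Matrix.conjTranspose_apply]
    refine Finset.sum_congr rfl fun e _ => ?_
    rw [Matrix.mul_apply (N := (T * Sᴴ)ᴴ), Finset.sum_eq_single a]
    · rw [Matrix.mul_single_apply_same, Matrix.conjTranspose_apply]; ring
    · intro c _ hc
      rw [Matrix.mul_single_apply_of_ne _ _ _ _ _ hc, zero_mul]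
    · simp
  rw [scaledEntropy, scaledEntropy, trace_traceFst, trace_traceFst, trace_isometry_conj hV.1,
    trace_isometry_conj hW.1, h1, h1, entropy_mul_conjTranspose_comm,
    entropy_mul_conjTranspose_comm, h2 E V hV, h2 E' W hW]

section Informations

variable {N : Matrix A A ℂ →ₗ[ℂ] Matrix B B ℂ} {V : Matrix (B × E) A ℂ}

lemma isometry_conj_weighted_posSemidef (𝓔 : Ensemble A) (V : Matrix (B × E) A ℂ) (x y) :
    (V * 𝓔.weighted x y * Vᴴ).PosSemidef :=
  (𝓔.weighted_posSemidef x y).mul_mul_conjTranspose_same V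

lemma infoYXB_eq (hV : IsIsometricExtension N V) (𝓔 : Ensemble A) :
    infoYXB 𝓔 V = scaledEntropy (N (∑ x, ∑ y, 𝓔.weighted x y))
      - ∑ x, ∑ y, scaledEntropy (N (𝓔.weighted x y)) := by
  rw [infoYXB, stateXYB_eq, jointMutualInfo_cqMatrix]
  · simp only [hV.2, map_sum]
  · exact fun x y => traceSnd_posSemidef (isometry_conj_weighted_posSemidef 𝓔 V x y)
  · simp only [Matrix.trace_sum, trace_traceSnd, trace_isometry_conj hV.1]
    simpa only [Matrix.trace_sum] using 𝓔.trace_sum_weighted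

lemma infoYBgivenX_eq (hV : IsIsometricExtension N V) (𝓔 : Ensemble A) :
    infoYBgivenX 𝓔 V = ∑ x, scaledEntropy (N (∑ y, 𝓔.weighted x y))
      - ∑ x, ∑ y, scaledEntropy (N (𝓔.weighted x y)) := by
  rw [infoYBgivenX, stateXYB_eq, condMutualInfo_cqMatrix]
  · simp only [hV.2, map_sum]
  · exact fun x y => traceSnd_posSemidef (isometry_conj_weighted_posSemidef 𝓔 V x y)

/-- `V` is an arbitrary extension, while the complementary channel `Nc` may be computed from a
convenient one, `W`. -/
lemma infoYEgivenX_eq {W : Matrix (B × E') A ℂ} {Nc : Matrix A A ℂ →ₗ[ℂ] Matrix E' E' ℂ}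
    (hV : IsIsometricExtension N V) (hW : IsIsometricExtension N W)
    (hNc : ∀ ρ, traceFst (W * ρ * Wᴴ) = Nc ρ) (𝓔 : Ensemble A) :
    infoYEgivenX 𝓔 V = ∑ x, scaledEntropy (Nc (∑ y, 𝓔.weighted x y))
      - ∑ x, ∑ y, scaledEntropy (Nc (𝓔.weighted x y)) := by
  have hsum : ∀ x, (∑ y, traceFst (V * 𝓔.weighted x y * Vᴴ)) =
      traceFst (V * (∑ y, 𝓔.weighted x y) * Vᴴ) := fun x => by
    ext e e'
    simp only [traceFst, Matrix.sum_apply, Matrix.of_apply]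
    rw [Finset.sum_comm]
    simp [Matrix.mul_sum, Matrix.sum_mul, Matrix.sum_apply]
  rw [infoYEgivenX, stateXYE_eq, condMutualInfo_cqMatrix]
  · simp only [hsum, ← hNc]
    congr 1
    · exact Finset.sum_congr rfl fun x _ => scaledEntropy_traceFst_eq hV hW
        (Matrix.posSemidef_sum _ fun y _ => 𝓔.weighted_posSemidef x y)
    · exact Finset.sum_congr rfl fun x _ => Finset.sum_congr rfl fun y _ =>
        scaledEntropy_traceFst_eq hV hW (𝓔.weighted_posSemidef x y)
  · exact fun x y => traceFst_posSemidef (isometry_conj_weighted_posSemidef 𝓔 V x y)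

end Informations

end Isometry

/-! ### Isometric extensions of tensor products -/

section Extensions

variable {A A' B B' E E' : Type} [Fintype A] [DecidableEq A] [Fintype B] [DecidableEq B]
  [Fintype E] [DecidableEq E] [Fintype A'] [DecidableEq A'] [Fintype B'] [DecidableEq B']
  [Fintype E'] [DecidableEq E']

lemma IsIsometricExtension.reindex {N : Matrix A A ℂ →ₗ[ℂ] Matrix B B ℂ}
    {V : Matrix (B × E) A ℂ} (hV : IsIsometricExtension N V) (e : E' ≃ E) :
    IsIsometricExtension N (V.submatrix (Equiv.prodCongr (Equiv.refl B) e) id) := by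
  constructor
  · rw [Matrix.conjTranspose_submatrix, Matrix.submatrix_mul_equiv, hV.1, Matrix.submatrix_id_id]
  · intro ρ
    rw [← hV.2 ρ]
    ext b b'
    simp only [traceSnd, Matrix.of_apply]
    exact Fintype.sum_equiv e _ _ fun x => rfl

lemma IsIsometricExtension.exists_fin {N : Matrix A A ℂ →ₗ[ℂ] Matrix B B ℂ}
    {V : Matrix (B × E) A ℂ} (hV : IsIsometricExtension N V) :
    ∃ (d : ℕ) (W : Matrix (B × Fin d) A ℂ), IsIsometricExtension N W :=
  ⟨_, _, hV.reindex (Fintype.equivFin E).symm⟩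

/-- The tensor product of two isometries, with the outputs and the environments regrouped. -/
def tensorIsometry (V : Matrix (B × E) A ℂ) (V' : Matrix (B' × E') A' ℂ) :
    Matrix ((B × B') × (E × E')) (A × A') ℂ :=
  (V ⊗ₖ V').submatrix (Equiv.prodProdProdComm B B' E E') id

lemma tensorIsometry_conj_kronecker (V : Matrix (B × E) A ℂ) (V' : Matrix (B' × E') A' ℂ)
    (ρ : Matrix A A ℂ) (τ : Matrix A' A' ℂ) :
    tensorIsometry V V' * (ρ ⊗ₖ τ) * (tensorIsometry V V')ᴴ =
      ((V * ρ * Vᴴ) ⊗ₖ (V' * τ * V'ᴴ)).submatrix (Equiv.prodProdProdComm B B' E E')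
        (Equiv.prodProdProdComm B B' E E') := by
  rw [Matrix.mul_kronecker_mul, Matrix.mul_kronecker_mul, ← Matrix.conjTranspose_kronecker]
  rfl

/-- Matrix units of the product are Kronecker products of matrix units, so a linear map is
determined by its values on product inputs. -/
lemma eq_tensorMap_of_kronecker {N : Matrix A A ℂ →ₗ[ℂ] Matrix B B ℂ}
    {M : Matrix A' A' ℂ →ₗ[ℂ] Matrix B' B' ℂ}
    {f : Matrix (A × A') (A × A') ℂ →ₗ[ℂ] Matrix (B × B') (B × B') ℂ}
    (h : ∀ ρ τ, f (ρ ⊗ₖ τ) = N ρ ⊗ₖ M τ) : f = tensorMap N M := by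
  refine Matrix.ext_linearMap _ fun i j => LinearMap.ext_ring ?_
  have hs : Matrix.single i j (1 : ℂ) =
      Matrix.single i.1 j.1 (1 : ℂ) ⊗ₖ Matrix.single i.2 j.2 (1 : ℂ) := by
    rw [Matrix.single_kronecker_single, mul_one]
  simp only [LinearMap.comp_apply, Matrix.singleLinearMap_apply, hs, h, tensorMap_kronecker]

/-- Conjugation by a matrix followed by the partial trace over the environment. -/
def conjTraceSnd (V : Matrix (B × E) A ℂ) : Matrix A A ℂ →ₗ[ℂ] Matrix B B ℂ where
  toFun ρ := traceSnd (V * ρ * Vᴴ)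
  map_add' ρ τ := by
    ext
    simp [traceSnd, Matrix.mul_add, Matrix.add_mul, Finset.sum_add_distrib]
  map_smul' c ρ := by
    ext
    simp [traceSnd, Finset.mul_sum]

/-- Conjugation by a matrix followed by the partial trace over the output. -/
def conjTraceFst (V : Matrix (B × E) A ℂ) : Matrix A A ℂ →ₗ[ℂ] Matrix E E ℂ where
  toFun ρ := traceFst (V * ρ * Vᴴ)
  map_add' ρ τ := by
    ext
    simp [traceFst, Matrix.mul_add, Matrix.add_mul, Finset.sum_add_distrib]
  map_smul' c ρ := by
    ext
    simp [traceFst, Finset.mul_sum]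

lemma IsIsometricExtension.tensor {N : Matrix A A ℂ →ₗ[ℂ] Matrix B B ℂ}
    {M : Matrix A' A' ℂ →ₗ[ℂ] Matrix B' B' ℂ} {V : Matrix (B × E) A ℂ}
    {V' : Matrix (B' × E') A' ℂ} (hV : IsIsometricExtension N V)
    (hV' : IsIsometricExtension M V') :
    IsIsometricExtension (tensorMap N M) (tensorIsometry V V') := by
  constructor
  · rw [tensorIsometry, Matrix.conjTranspose_submatrix, Matrix.submatrix_mul_equiv,
      Matrix.conjTranspose_kronecker, ← Matrix.mul_kronecker_mul, hV.1, hV'.1,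
      Matrix.one_kronecker_one, Matrix.submatrix_id_id]
  · have h : conjTraceSnd (tensorIsometry V V') = tensorMap N M := by
      refine eq_tensorMap_of_kronecker fun ρ τ => ?_
      rw [← hV.2, ← hV'.2]
      ext ⟨b, b'⟩ ⟨c, c'⟩
      simp [conjTraceSnd, tensorIsometry_conj_kronecker, traceSnd, Fintype.sum_prod_type,
        Finset.sum_mul_sum]
    exact fun ρ => congrArg (fun f => f ρ) h

lemma traceFst_tensorIsometry {N : Matrix A A ℂ →ₗ[ℂ] Matrix E E ℂ}
    {M : Matrix A' A' ℂ →ₗ[ℂ] Matrix E' E' ℂ} {V : Matrix (B × E) A ℂ}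
    {V' : Matrix (B' × E') A' ℂ} (hV : ∀ ρ, traceFst (V * ρ * Vᴴ) = N ρ)
    (hV' : ∀ ρ, traceFst (V' * ρ * V'ᴴ) = M ρ) (ρ : Matrix (A × A') (A × A') ℂ) :
    traceFst (tensorIsometry V V' * ρ * (tensorIsometry V V')ᴴ) = tensorMap N M ρ := by
  have h : conjTraceFst (tensorIsometry V V') = tensorMap N M := by
    refine eq_tensorMap_of_kronecker fun ρ τ => ?_
    rw [← hV, ← hV']
    ext ⟨b, b'⟩ ⟨c, c'⟩
    simp [conjTraceFst, tensorIsometry_conj_kronecker, traceFst, Fintype.sum_prod_type,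
      Finset.sum_mul_sum]
  exact congrArg (fun f => f ρ) h

end Extensions

/-! ### The erasure channel, its complement, and two copies -/

section Erasure

/-- The isometric extension of the erasure channel that sends the input to the output with
amplitude `√(1 - ε)` and to the environment with amplitude `√ε`. -/
noncomputable def erasureIsometry (ε : ℝ) :
    Matrix ((Fin 2 ⊕ Unit) × (Fin 2 ⊕ Unit)) (Fin 2) ℂ :=
  Matrix.of fun i a => match i with
    | (Sum.inl b, Sum.inr _) => if b = a then (√(1 - ε) : ℂ) else 0
    | (Sum.inr _, Sum.inl e) => if e = a then (√ε : ℂ) else 0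
    | _ => 0

lemma ofReal_sqrt_mul_self {x : ℝ} (hx : 0 ≤ x) : (√x : ℂ) * √x = x := by
  rw [← Complex.ofReal_mul, Real.mul_self_sqrt hx]

lemma erasureIsometry_isIsometricExtension {ε : ℝ} (hε : ε ∈ Set.Icc (0 : ℝ) 1) :
    IsIsometricExtension (erasureChannel ε) (erasureIsometry ε) := by
  have h0 := ofReal_sqrt_mul_self hε.1
  have h1 := ofReal_sqrt_mul_self (sub_nonneg.2 hε.2)
  constructor
  · ext a a'
    fin_cases a <;> fin_cases a' <;>
      simp [Matrix.mul_apply, Fintype.sum_prod_type, erasureIsometry, h0, h1]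
  · intro ρ
    push_cast at h1
    ext b b'
    rcases b with b | b <;> rcases b' with b' | b' <;>
      simp [traceSnd, Matrix.mul_apply, erasureIsometry, erasureChannel, Matrix.trace]
    · fin_cases b <;> fin_cases b' <;> simp
      · linear_combination ρ 0 0 * h1
      · linear_combination ρ 0 1 * h1
      · linear_combination ρ 1 0 * h1
      · linear_combination ρ 1 1 * h1
    · linear_combination (ρ 0 0 + ρ 1 1) * h0

/-- The isometry sends the input either to the output or to the environment and a flag to the other
side, so exchanging the sides exchanges ε and 1 - ε. -/
lemma traceFst_erasureIsometry {ε : ℝ} (hε : ε ∈ Set.Icc (0 : ℝ) 1)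
    (ρ : Matrix (Fin 2) (Fin 2) ℂ) :
    traceFst (erasureIsometry ε * ρ * (erasureIsometry ε)ᴴ) = erasureChannel (1 - ε) ρ := by
  have h0 := ofReal_sqrt_mul_self hε.1
  have h1 := ofReal_sqrt_mul_self (sub_nonneg.2 hε.2)
  push_cast at h1
  ext b b'
  rcases b with b | b <;> rcases b' with b' | b' <;>
    simp [traceFst, Matrix.mul_apply, erasureIsometry, erasureChannel, Matrix.trace]
  · fin_cases b <;> fin_cases b' <;> simp
    · linear_combination ρ 0 0 * h0
    · linear_combination ρ 0 1 * h0
    · linear_combination ρ 1 0 * h0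
    · linear_combination ρ 1 1 * h0
  · linear_combination (ρ 0 0 + ρ 1 1) * h1

lemma trace_fromBlocks {K L : Type} [Fintype K] [Fintype L] (A : Matrix K K ℂ) (B : Matrix K L ℂ)
    (C : Matrix L K ℂ) (D : Matrix L L ℂ) :
    (Matrix.fromBlocks A B C D).trace = A.trace + D.trace := by
  simp [Matrix.trace]

lemma scaledEntropy_fromBlocks {K L : Type} [Fintype K] [DecidableEq K] [Fintype L] [DecidableEq L]
    {A : Matrix K K ℂ} {B : Matrix L L ℂ} (hA : A.IsHermitian) (hB : B.IsHermitian) :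
    scaledEntropy (Matrix.fromBlocks A 0 0 B) = scaledEntropy A + scaledEntropy B
      + (eta A.trace.re + eta B.trace.re - eta (A.trace.re + B.trace.re)) := by
  simp only [scaledEntropy, entropy_fromBlocks_zero hA hB, trace_fromBlocks, Complex.add_re]
  ring

lemma posSemidef_of_const {K : Type} [Fintype K] [DecidableEq K] [Subsingleton K] {t : ℂ}
    (ht : 0 ≤ t) : (Matrix.of fun _ _ : K => t).PosSemidef := by
  have : (Matrix.of fun _ _ : K => t) = Matrix.diagonal fun _ => t := by
    ext i j
    rw [Subsingleton.elim i j]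
    simp
  rw [this]
  exact Matrix.PosSemidef.diagonal fun _ => ht

lemma scaledEntropy_of_subsingleton {K : Type} [Fintype K] [DecidableEq K] [Nonempty K]
    [Subsingleton K] {A : Matrix K K ℂ} (hA : A.PosSemidef) : scaledEntropy A = 0 := by
  refine le_antisymm ?_ (scaledEntropy_nonneg hA)
  have h : Fintype.card K = 1 :=
    le_antisymm (Fintype.card_le_one_iff_subsingleton.2 inferInstance) Fintype.card_pos
  simpa [h] using scaledEntropy_le hA

lemma isHermitian_ofReal_smul {K : Type} {A : Matrix K K ℂ} (hA : A.IsHermitian) (c : ℝ) :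
    ((c : ℂ) • A).IsHermitian := by
  rw [Matrix.IsHermitian, Matrix.conjTranspose_smul, hA.eq]; simp

/-- The output is (1 - ε)τ ⊕ ε Tr τ. The flag block has no entropy of its own, and the uncertainty
about erasure contributes only a multiple of the trace. -/
lemma scaledEntropy_erasureChannel (ε : ℝ) {τ : Matrix (Fin 2) (Fin 2) ℂ} (hτ : τ.PosSemidef) :
    scaledEntropy (erasureChannel ε τ) =
      (1 - ε) * scaledEntropy τ + τ.trace.re * (eta (1 - ε) + eta ε) := by
  have hu : (Matrix.of fun _ _ : Unit => τ.trace).PosSemidef :=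
    posSemidef_of_const hτ.trace_nonneg
  have h : erasureChannel ε τ = Matrix.fromBlocks (((1 - ε : ℝ) : ℂ) • τ) 0 0
      ((ε : ℂ) • Matrix.of fun _ _ => τ.trace) := by
    simp [erasureChannel]
  rw [h, scaledEntropy_fromBlocks (isHermitian_ofReal_smul hτ.1 _)
    (isHermitian_ofReal_smul hu.1 _), scaledEntropy_smul _ hτ.1, scaledEntropy_smul _ hu.1,
    scaledEntropy_of_subsingleton hu]
  have ht : (Matrix.of fun _ _ : Unit => τ.trace).trace = τ.trace := by simp [Matrix.trace]
  simp only [Matrix.trace_smul, ht, smul_eq_mul, Complex.re_ofReal_mul, eta_mul]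
  rw [show (1 - ε) * τ.trace.re + ε * τ.trace.re = τ.trace.re by ring]
  ring

/-- The decomposition of the output of two erasure channels according to the erased systems. -/
def erasurePatternEquiv : (Fin 2 ⊕ Unit) × (Fin 2 ⊕ Unit) ≃
    ((Fin 2 × Fin 2) ⊕ (Fin 2 × Unit)) ⊕ ((Unit × Fin 2) ⊕ (Unit × Unit)) :=
  (Equiv.sumProdDistrib _ _ _).trans
    (Equiv.sumCongr (Equiv.prodSumDistrib _ _ _) (Equiv.prodSumDistrib _ _ _))

/-- The output of two erasure channels as a direct sum over the erased systems. -/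
def erasurePatternMap (ε : ℝ) : Matrix (Fin 2 × Fin 2) (Fin 2 × Fin 2) ℂ →ₗ[ℂ]
    Matrix ((Fin 2 ⊕ Unit) × (Fin 2 ⊕ Unit)) ((Fin 2 ⊕ Unit) × (Fin 2 ⊕ Unit)) ℂ where
  toFun τ := Matrix.reindex erasurePatternEquiv.symm erasurePatternEquiv.symm
    (Matrix.fromBlocks
      (Matrix.fromBlocks ((((1 - ε) * (1 - ε) : ℝ) : ℂ) • τ) 0 0
        ((((1 - ε) * ε : ℝ) : ℂ) • (traceSnd τ).submatrix Prod.fst Prod.fst)) 0 0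
      (Matrix.fromBlocks ((((1 - ε) * ε : ℝ) : ℂ) • (traceFst τ).submatrix Prod.snd Prod.snd) 0 0
        (((ε * ε : ℝ) : ℂ) • Matrix.of fun _ _ => τ.trace)))
  map_add' τ τ' := by
    ext ⟨i | i, j | j⟩ ⟨i' | i', j' | j'⟩ <;>
      simp [erasurePatternEquiv, traceSnd, traceFst, Matrix.trace_add] <;> ring
  map_smul' c τ := by
    ext ⟨i | i, j | j⟩ ⟨i' | i', j' | j'⟩ <;>
      simp [erasurePatternEquiv, traceSnd, traceFst, Matrix.trace_smul] <;> ring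

lemma tensorMap_erasureChannel (ε : ℝ) :
    tensorMap (erasureChannel ε) (erasureChannel ε) = erasurePatternMap ε := by
  refine (eq_tensorMap_of_kronecker fun ρ τ => ?_).symm
  ext ⟨i | i, j | j⟩ ⟨i' | i', j' | j'⟩ <;>
    simp [erasurePatternMap, erasurePatternEquiv, erasureChannel, traceSnd, traceFst,
      Matrix.trace, Fintype.sum_prod_type] <;> ring

lemma trace_submatrix_equiv {K L : Type} [Fintype K] [Fintype L] (A : Matrix K K ℂ) (e : L ≃ K) :
    (A.submatrix e e).trace = A.trace :=
  Fintype.sum_equiv e _ _ fun _ => rfl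

/-- The four blocks carry both inputs, one of them (twice), or none. The constant is left
existential because it cancels in every information. -/
lemma scaledEntropy_tensorMap_erasureChannel (ε : ℝ) :
    ∃ c : ℝ, ∀ τ : Matrix (Fin 2 × Fin 2) (Fin 2 × Fin 2) ℂ, τ.PosSemidef →
      scaledEntropy (tensorMap (erasureChannel ε) (erasureChannel ε) τ) =
        (1 - ε) ^ 2 * scaledEntropy τ
        + ε * (1 - ε) * (scaledEntropy (traceSnd τ) + scaledEntropy (traceFst τ))
        + τ.trace.re * c := by
  refine ⟨eta ((1 - ε) * (1 - ε)) + 2 * eta ((1 - ε) * ε) + eta (ε * ε), fun τ hτ => ?_⟩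
  have hu : (Matrix.of fun _ _ : Unit × Unit => τ.trace).PosSemidef :=
    posSemidef_of_const hτ.trace_nonneg
  have ht : (Matrix.of fun _ _ : Unit × Unit => τ.trace).trace = τ.trace := by simp [Matrix.trace]
  have h1 := traceSnd_isHermitian hτ.1
  have h2 := traceFst_isHermitian hτ.1
  have e1 : ((traceSnd τ).submatrix Prod.fst Prod.fst : Matrix (Fin 2 × Unit) (Fin 2 × Unit) ℂ) =
    Matrix.reindex (Equiv.prodPUnit (Fin 2)).symm (Equiv.prodPUnit (Fin 2)).symm (traceSnd τ) := rfl
  have e2 : ((traceFst τ).submatrix Prod.snd Prod.snd : Matrix (Unit × Fin 2) (Unit × Fin 2) ℂ) =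
    Matrix.reindex (Equiv.punitProd (Fin 2)).symm (Equiv.punitProd (Fin 2)).symm (traceFst τ) := rfl
  have t1 : ((traceSnd τ).submatrix Prod.fst Prod.fst :
      Matrix (Fin 2 × Unit) (Fin 2 × Unit) ℂ).trace = τ.trace :=
    (trace_submatrix_equiv _ (Equiv.prodPUnit (Fin 2))).trans (trace_traceSnd τ)
  have t2 : ((traceFst τ).submatrix Prod.snd Prod.snd :
      Matrix (Unit × Fin 2) (Unit × Fin 2) ℂ).trace = τ.trace :=
    (trace_submatrix_equiv _ (Equiv.punitProd (Fin 2))).trans (trace_traceFst τ)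
  have hA := isHermitian_ofReal_smul hτ.1 ((1 - ε) * (1 - ε))
  have hB := isHermitian_ofReal_smul (h1.submatrix (Prod.fst : Fin 2 × Unit → Fin 2))
    ((1 - ε) * ε)
  have hC := isHermitian_ofReal_smul (h2.submatrix (Prod.snd : Unit × Fin 2 → Fin 2))
    ((1 - ε) * ε)
  have hD := isHermitian_ofReal_smul hu.1 (ε * ε)
  rw [tensorMap_erasureChannel]
  simp only [erasurePatternMap, LinearMap.coe_mk, AddHom.coe_mk]
  rw [scaledEntropy_reindex _ ((hA.fromBlocks (by simp) hB).fromBlocks (by simp)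
      (hC.fromBlocks (by simp) hD)),
    scaledEntropy_fromBlocks (hA.fromBlocks (by simp) hB) (hC.fromBlocks (by simp) hD),
    scaledEntropy_fromBlocks hA hB, scaledEntropy_fromBlocks hC hD, scaledEntropy_smul _ hτ.1,
    scaledEntropy_smul _ (h1.submatrix _), scaledEntropy_smul _ (h2.submatrix _),
    scaledEntropy_smul _ hu.1, scaledEntropy_of_subsingleton hu, e1, e2, scaledEntropy_reindex _ h1,
    scaledEntropy_reindex _ h2, ← e1, ← e2]
  simp only [Matrix.trace_smul, trace_fromBlocks, ht, t1, t2, smul_eq_mul, Complex.add_re,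
    Complex.re_ofReal_mul]
  rw [show (1 - ε) * (1 - ε) * τ.trace.re + (1 - ε) * ε * τ.trace.re
    + ((1 - ε) * ε * τ.trace.re + ε * ε * τ.trace.re) = τ.trace.re by ring]
  rw [eta_mul ((1 - ε) * (1 - ε)), eta_mul ((1 - ε) * ε), eta_mul (ε * ε)]
  ring

end Erasure

/-! ### The three ensemble averages and their comparison -/

section EnsembleAverages

variable {A B E E' : Type} [Fintype A] [DecidableEq A] [Fintype B] [DecidableEq B]
  [Fintype E] [DecidableEq E] [Fintype E'] [DecidableEq E']

/-- The value of `g` at the average state. -/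
noncomputable def Ensemble.ofMean (𝓔 : Ensemble A) (g : Matrix A A ℂ → ℝ) : ℝ :=
  g (∑ x, ∑ y, 𝓔.weighted x y)

/-- The average over `x` of `g` at the average over `y` of the states. -/
noncomputable def Ensemble.condMean (𝓔 : Ensemble A) (g : Matrix A A ℂ → ℝ) : ℝ :=
  ∑ x, g (∑ y, 𝓔.weighted x y)

/-- The average over `x` and `y` of `g` at the states. -/
noncomputable def Ensemble.mean (𝓔 : Ensemble A) (g : Matrix A A ℂ → ℝ) : ℝ :=
  ∑ x, ∑ y, g (𝓔.weighted x y)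

variable (𝓔 : Ensemble A)

lemma Ensemble.sum_weighted_posSemidef (x) : (∑ y, 𝓔.weighted x y).PosSemidef :=
  Matrix.posSemidef_sum _ fun y _ => 𝓔.weighted_posSemidef x y

lemma Ensemble.sum_sum_weighted_posSemidef : (∑ x, ∑ y, 𝓔.weighted x y).PosSemidef :=
  Matrix.posSemidef_sum _ fun x _ => 𝓔.sum_weighted_posSemidef x

lemma Ensemble.mean_trace : 𝓔.mean (fun τ => τ.trace.re) = 1 := by
  have h := congrArg Complex.re 𝓔.trace_sum_weighted
  simpa only [Ensemble.mean, Matrix.trace_sum, Complex.re_sum, Complex.one_re] using h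

lemma Ensemble.condMean_trace : 𝓔.condMean (fun τ => τ.trace.re) = 1 := by
  have h := congrArg Complex.re 𝓔.trace_sum_weighted
  rwa [Matrix.trace_sum, Complex.re_sum, Complex.one_re] at h

variable {𝓔} {f g : Matrix A A ℂ → ℝ} {c : ℝ}

/-- The ensemble has total trace one, so a term Tr τ · c shifts each of the three averages by the
same c and drops out of their differences. -/
lemma Ensemble.ofMean_affine (h : ∀ τ, τ.PosSemidef → f τ = g τ + τ.trace.re * c) :
    𝓔.ofMean f = 𝓔.ofMean g + c := by
  rw [Ensemble.ofMean, h _ 𝓔.sum_sum_weighted_posSemidef, 𝓔.trace_sum_weighted, Complex.one_re,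
    one_mul]
  rfl

lemma Ensemble.condMean_affine (h : ∀ τ, τ.PosSemidef → f τ = g τ + τ.trace.re * c) :
    𝓔.condMean f = 𝓔.condMean g + c := by
  have ht := 𝓔.condMean_trace
  simp only [Ensemble.condMean] at ht ⊢
  simp only [h _ (𝓔.sum_weighted_posSemidef _), Finset.sum_add_distrib, ← Finset.sum_mul, ht,
    one_mul]

lemma Ensemble.mean_affine (h : ∀ τ, τ.PosSemidef → f τ = g τ + τ.trace.re * c) :
    𝓔.mean f = 𝓔.mean g + c := by
  have ht := 𝓔.mean_trace
  simp only [Ensemble.mean] at ht ⊢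
  simp only [h _ (𝓔.weighted_posSemidef _ _), Finset.sum_add_distrib, ← Finset.sum_mul, ht,
    one_mul]

lemma Ensemble.condMean_mono (h : ∀ τ, τ.PosSemidef → f τ ≤ g τ) :
    𝓔.condMean f ≤ 𝓔.condMean g :=
  Finset.sum_le_sum fun x _ => h _ (𝓔.sum_weighted_posSemidef x)

lemma Ensemble.mean_mono (h : ∀ τ, τ.PosSemidef → f τ ≤ g τ) : 𝓔.mean f ≤ 𝓔.mean g :=
  Finset.sum_le_sum fun x _ => Finset.sum_le_sum fun y _ => h _ (𝓔.weighted_posSemidef x y)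

lemma Ensemble.mean_scaledEntropy_nonneg : 0 ≤ 𝓔.mean scaledEntropy :=
  Finset.sum_nonneg fun x _ => Finset.sum_nonneg fun y _ =>
    scaledEntropy_nonneg (𝓔.weighted_posSemidef x y)

lemma Ensemble.mean_le_condMean_scaledEntropy :
    𝓔.mean scaledEntropy ≤ 𝓔.condMean scaledEntropy :=
  Finset.sum_le_sum fun x _ => sum_scaledEntropy_le fun y => 𝓔.weighted_posSemidef x y

lemma Ensemble.condMean_scaledEntropy_le [Nonempty A] :
    𝓔.condMean scaledEntropy ≤ Real.logb 2 (Fintype.card A) := by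
  refine (Ensemble.condMean_mono fun τ hτ => scaledEntropy_le hτ).trans_eq ?_
  have ht := 𝓔.condMean_trace
  simp only [Ensemble.condMean] at ht ⊢
  rw [← Finset.sum_mul, ht, one_mul]

lemma Ensemble.ofMean_scaledEntropy_le [Nonempty A] :
    𝓔.ofMean scaledEntropy ≤ Real.logb 2 (Fintype.card A) := by
  refine (scaledEntropy_le 𝓔.sum_sum_weighted_posSemidef).trans_eq ?_
  rw [𝓔.trace_sum_weighted, Complex.one_re, one_mul]

variable {N : Matrix A A ℂ →ₗ[ℂ] Matrix B B ℂ} {V : Matrix (B × E) A ℂ}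

lemma infoYXB_of_affine (hV : IsIsometricExtension N V)
    (h : ∀ τ, τ.PosSemidef → scaledEntropy (N τ) = g τ + τ.trace.re * c) :
    infoYXB 𝓔 V = 𝓔.ofMean g - 𝓔.mean g := by
  have h1 := 𝓔.ofMean_affine h
  have h2 := 𝓔.mean_affine h
  rw [infoYXB_eq hV]
  simp only [Ensemble.ofMean, Ensemble.mean] at h1 h2 ⊢
  linarith

lemma infoYBgivenX_of_affine (hV : IsIsometricExtension N V)
    (h : ∀ τ, τ.PosSemidef → scaledEntropy (N τ) = g τ + τ.trace.re * c) :
    infoYBgivenX 𝓔 V = 𝓔.condMean g - 𝓔.mean g := by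
  have h1 := 𝓔.condMean_affine h
  have h2 := 𝓔.mean_affine h
  rw [infoYBgivenX_eq hV]
  simp only [Ensemble.condMean, Ensemble.mean] at h1 h2 ⊢
  linarith

lemma infoYEgivenX_of_affine {W : Matrix (B × E') A ℂ} {Nc : Matrix A A ℂ →ₗ[ℂ] Matrix E' E' ℂ}
    (hV : IsIsometricExtension N V) (hW : IsIsometricExtension N W)
    (hNc : ∀ ρ, traceFst (W * ρ * Wᴴ) = Nc ρ)
    (h : ∀ τ, τ.PosSemidef → scaledEntropy (Nc τ) = g τ + τ.trace.re * c) :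
    infoYEgivenX 𝓔 V = 𝓔.condMean g - 𝓔.mean g := by
  have h1 := 𝓔.condMean_affine h
  have h2 := 𝓔.mean_affine h
  rw [infoYEgivenX_eq hV hW hNc]
  simp only [Ensemble.condMean, Ensemble.mean] at h1 h2 ⊢
  linarith

end EnsembleAverages

/-! ### Ensembles of computational basis states -/

section BasisEnsemble

variable {A : Type} [Fintype A] [DecidableEq A]

lemma single_eq_diagonal (k : A) (p : ℝ) :
    Matrix.single k k (p : ℂ) = Matrix.diagonal fun i => ((if i = k then p else 0 : ℝ) : ℂ) := by
  ext i j
  by_cases h : i = j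
  · subst h
    by_cases hk : i = k
    · simp [hk]
    · simp [hk, Ne.symm hk]
  · rw [Matrix.diagonal_apply_ne _ h, Matrix.single_apply, if_neg]
    rintro ⟨rfl, rfl⟩
    exact h rfl

lemma scaledEntropy_single (k : A) (p : ℝ) : scaledEntropy (Matrix.single k k (p : ℂ)) = 0 := by
  rw [single_eq_diagonal, scaledEntropy_diagonal]
  simp [apply_ite eta]

lemma isDensity_single (k : A) : IsDensity (Matrix.single k k (1 : ℂ)) := by
  refine ⟨?_, by simp⟩
  rw [← Complex.ofReal_one, single_eq_diagonal]
  refine Matrix.PosSemidef.diagonal fun i => ?_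
  by_cases h : i = k <;> simp [h]

/-- An ensemble of computational basis states. -/
def basisEnsemble {m n : ℕ} (prob : Fin m → Fin n → ℝ) (prob_nonneg : ∀ x y, 0 ≤ prob x y)
    (prob_sum : ∑ x, ∑ y, prob x y = 1) (k : Fin m → Fin n → A) : Ensemble A where
  cardX := m
  cardY := n
  prob := prob
  prob_nonneg := prob_nonneg
  prob_sum := prob_sum
  state x y := Matrix.single (k x y) (k x y) 1
  state_density x y := isDensity_single (k x y)

variable {m n : ℕ} {prob : Fin m → Fin n → ℝ} {prob_nonneg : ∀ x y, 0 ≤ prob x y}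
  {prob_sum : ∑ x, ∑ y, prob x y = 1} {k : Fin m → Fin n → A}

lemma basisEnsemble_weighted (x : Fin m) (y : Fin n) :
    (basisEnsemble prob prob_nonneg prob_sum k).weighted x y =
      Matrix.single (k x y) (k x y) (prob x y : ℂ) := by
  simp [Ensemble.weighted, basisEnsemble, Matrix.smul_single]

lemma ofMean_basisEnsemble (g : Matrix A A ℂ → ℝ) :
    (basisEnsemble prob prob_nonneg prob_sum k).ofMean g =
      g (∑ x, ∑ y, Matrix.single (k x y) (k x y) (prob x y : ℂ)) :=
  congrArg g (Finset.sum_congr rfl fun x _ => Finset.sum_congr rfl fun y _ =>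
    basisEnsemble_weighted x y)

lemma condMean_basisEnsemble (g : Matrix A A ℂ → ℝ) :
    (basisEnsemble prob prob_nonneg prob_sum k).condMean g =
      ∑ x, g (∑ y, Matrix.single (k x y) (k x y) (prob x y : ℂ)) :=
  Finset.sum_congr rfl fun x _ => congrArg g (Finset.sum_congr rfl fun y _ =>
    basisEnsemble_weighted x y)

lemma mean_basisEnsemble (g : Matrix A A ℂ → ℝ) :
    (basisEnsemble prob prob_nonneg prob_sum k).mean g =
      ∑ x, ∑ y, g (Matrix.single (k x y) (k x y) (prob x y : ℂ)) :=
  Finset.sum_congr rfl fun x _ => Finset.sum_congr rfl fun y _ =>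
    congrArg g (basisEnsemble_weighted x y)

end BasisEnsemble

/-! ### Binary entropy -/

section BinaryEntropy

lemma binaryEntropy_eq (p : ℝ) : binaryEntropy p = eta p + eta (1 - p) := by
  rw [binaryEntropy, eta_eq, eta_eq]; ring

lemma continuous_binaryEntropy : Continuous binaryEntropy := by
  have h : Continuous eta := Real.continuous_negMulLog.div_const _
  rw [funext binaryEntropy_eq]
  fun_prop

lemma eta_half : eta (1 / 2) = 1 / 2 := by
  rw [eta_eq, one_div, Real.logb_inv, Real.logb_self_eq_one one_lt_two]; ring

lemma binaryEntropy_half : binaryEntropy (1 / 2) = 1 := by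
  rw [binaryEntropy_eq, show (1 : ℝ) - 1 / 2 = 1 / 2 by norm_num, eta_half]; norm_num

lemma binaryEntropy_zero : binaryEntropy 0 = 0 := by simp [binaryEntropy_eq]

/-- By the intermediate value theorem every entropy difference in [0, 1] is some H₂(p); the p found
need not be related to the ensemble. -/
lemma exists_binaryEntropy_eq {d : ℝ} (hd : d ∈ Set.Icc (0 : ℝ) 1) :
    ∃ p ∈ Set.Icc (0 : ℝ) (1 / 2), binaryEntropy p = d := by
  have h := intermediate_value_Icc (by norm_num : (0 : ℝ) ≤ 1 / 2)
    continuous_binaryEntropy.continuousOn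
  rw [binaryEntropy_zero, binaryEntropy_half] at h
  exact h hd

end BinaryEntropy

/-! ### One copy: informations, region and maximum -/

section SingleCopy

variable {ε : ℝ}

lemma infos_erasureChannel (hε : ε ∈ Set.Icc (0 : ℝ) 1) {E : Type} [Fintype E] [DecidableEq E]
    {V : Matrix ((Fin 2 ⊕ Unit) × E) (Fin 2) ℂ} (hV : IsIsometricExtension (erasureChannel ε) V)
    (𝓔 : Ensemble (Fin 2)) :
    infoYXB 𝓔 V = (1 - ε) * (𝓔.ofMean scaledEntropy - 𝓔.mean scaledEntropy) ∧
    infoYBgivenX 𝓔 V = (1 - ε) * (𝓔.condMean scaledEntropy - 𝓔.mean scaledEntropy) ∧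
    infoYEgivenX 𝓔 V = ε * (𝓔.condMean scaledEntropy - 𝓔.mean scaledEntropy) := by
  have h : ∀ (δ : ℝ) (τ : Matrix (Fin 2) (Fin 2) ℂ), τ.PosSemidef → _ := fun δ τ hτ =>
    scaledEntropy_erasureChannel δ hτ
  refine ⟨?_, ?_, ?_⟩
  · rw [infoYXB_of_affine hV (h ε)]
    simp only [Ensemble.ofMean, Ensemble.mean, ← Finset.mul_sum]
    ring
  · rw [infoYBgivenX_of_affine hV (h ε)]
    simp only [Ensemble.condMean, Ensemble.mean, ← Finset.mul_sum]
    ring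
  · rw [infoYEgivenX_of_affine hV (erasureIsometry_isIsometricExtension hε)
      (traceFst_erasureIsometry hε) (h (1 - ε))]
    simp only [Ensemble.condMean, Ensemble.mean, ← Finset.mul_sum]
    ring

/-- A uniform bit `X` and a bit `Y` of bias `p`; the input is the basis state `X + Y`. -/
lemma exists_ensemble_binaryEntropy {p : ℝ} (hp : p ∈ Set.Icc (0 : ℝ) (1 / 2)) :
    ∃ 𝓔 : Ensemble (Fin 2), 𝓔.ofMean scaledEntropy = 1 ∧
      𝓔.condMean scaledEntropy = binaryEntropy p ∧ 𝓔.mean scaledEntropy = 0 := by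
  have h0 := hp.1
  have h1 : 0 ≤ 1 - p := by linarith [hp.2]
  have h11 : (1 : Fin 2) + 1 = 0 := rfl
  -- Uniform X makes the average input maximally mixed. Given x, the input has spectrum {p, 1 - p},
  -- and given both labels it is pure.
  refine ⟨basisEnsemble (fun (_ : Fin 2) (y : Fin 2) => 1 / 2 * if y = 0 then 1 - p else p)
    (fun x y => by split_ifs <;> positivity) (by simp [Fin.sum_univ_two])
    (fun x y => x + y), ?_, ?_, ?_⟩
  · rw [ofMean_basisEnsemble]
    simp only [single_eq_diagonal, Fin.sum_univ_two, Matrix.diagonal_add, ← Complex.ofReal_add,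
      scaledEntropy_diagonal, h11]
    norm_num
    rw [show 1 / 2 * (1 - p) + 1 / 2 * p = 1 / 2 by ring,
      show 1 / 2 * p + 1 / 2 * (1 - p) = 1 / 2 by ring, eta_half]
    norm_num
  · rw [condMean_basisEnsemble]
    simp only [single_eq_diagonal, Fin.sum_univ_two, Matrix.diagonal_add, ← Complex.ofReal_add,
      scaledEntropy_diagonal, h11]
    norm_num
    rw [show 1 / 2 * (1 - p) + 1 / 2 * p = 1 / 2 by ring,
      show 1 / 2 * p + 1 / 2 * (1 - p) = 1 / 2 by ring, binaryEntropy_eq, eta_mul, eta_mul]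
    ring
  · rw [mean_basisEnsemble]
    simp [scaledEntropy_single]

lemma Ensemble.qubit_bounds (𝓔 : Ensemble (Fin 2)) :
    𝓔.ofMean scaledEntropy - 𝓔.mean scaledEntropy ≤ 1 ∧
    𝓔.condMean scaledEntropy - 𝓔.mean scaledEntropy ∈ Set.Icc (0 : ℝ) 1 := by
  have hlog : Real.logb 2 (Fintype.card (Fin 2)) = 1 := by simp
  have h1 := 𝓔.ofMean_scaledEntropy_le
  have h2 := 𝓔.condMean_scaledEntropy_le
  have h3 := 𝓔.mean_scaledEntropy_nonneg
  have h4 := 𝓔.mean_le_condMean_scaledEntropy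
  rw [hlog] at h1 h2
  exact ⟨by linarith, by linarith, by linarith⟩

/-- An ensemble enters only through the differences h - b ≤ 1 and a - b in [0, 1]. Raising the first
to 1 only relaxes the bounds, the second is some H₂(p), and all such pairs are attained. -/
lemma oneShotRegion_erasureChannel (hε : ε ∈ Set.Icc (0 : ℝ) 1) :
    oneShotRegion (erasureChannel ε) =
      {r : ℝ × ℝ × ℝ | ∃ p ∈ Set.Icc (0 : ℝ) (1 / 2),
        r.1 + r.2.1 ≤ 1 - ε ∧
        r.2.1 + r.2.2 ≤ (1 - 2 * ε) * binaryEntropy p ∧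
        r.1 + r.2.1 + r.2.2 ≤ 1 - ε - ε * binaryEntropy p} := by
  ext r
  constructor
  · rintro ⟨𝓔, d, V, hV, h1, h2, h3⟩
    obtain ⟨e1, e2, e3⟩ := infos_erasureChannel hε hV 𝓔
    obtain ⟨b1, b2⟩ := 𝓔.qubit_bounds
    obtain ⟨p, hp, hpd⟩ := exists_binaryEntropy_eq b2
    rw [e1] at h1 h3
    rw [e2, e3] at h2
    rw [e3] at h3
    have h5 := mul_le_mul_of_nonneg_left b1 (sub_nonneg.2 hε.2)
    refine ⟨p, hp, ?_, ?_, ?_⟩ <;> rw [mul_one] at h5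
    · linarith
    · rw [hpd]; linarith
    · rw [hpd]; linarith
  · rintro ⟨p, hp, h1, h2, h3⟩
    obtain ⟨𝓔, v1, v2, v3⟩ := exists_ensemble_binaryEntropy hp
    obtain ⟨d, V, hV⟩ := (erasureIsometry_isIsometricExtension hε).exists_fin
    obtain ⟨e1, e2, e3⟩ := infos_erasureChannel hε hV 𝓔
    rw [v1, v3] at e1
    rw [v2, v3] at e2 e3
    refine ⟨𝓔, d, V, hV, ?_, ?_, ?_⟩
    · rw [e1]; linarith
    · rw [e2, e3]; linarith
    · rw [e1, e3]; linarith

variable {lam mu : ℝ}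

lemma mem_objectiveValues_erasureChannel (hε : ε ∈ Set.Icc (0 : ℝ) 1) {p : ℝ}
    (hp : p ∈ Set.Icc (0 : ℝ) (1 / 2)) :
    (1 - ε) + lam * (1 - 2 * ε) * binaryEntropy p + mu * ((1 - ε) - ε * binaryEntropy p) ∈
      objectiveValues (erasureChannel ε) lam mu := by
  obtain ⟨𝓔, v1, v2, v3⟩ := exists_ensemble_binaryEntropy hp
  obtain ⟨d, V, hV⟩ := (erasureIsometry_isIsometricExtension hε).exists_fin
  obtain ⟨e1, e2, e3⟩ := infos_erasureChannel hε hV 𝓔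
  refine ⟨𝓔, d, V, hV, ?_⟩
  rw [objective, e1, e2, e3, v1, v2, v3]
  ring

lemma exists_binaryEntropy_ge_objective (hε : ε ∈ Set.Icc (0 : ℝ) 1) (hmu : 0 ≤ mu) {v : ℝ}
    (hv : v ∈ objectiveValues (erasureChannel ε) lam mu) :
    ∃ p ∈ Set.Icc (0 : ℝ) (1 / 2), v ≤
      (1 - ε) + lam * (1 - 2 * ε) * binaryEntropy p + mu * ((1 - ε) - ε * binaryEntropy p) := by
  obtain ⟨𝓔, d, V, hV, rfl⟩ := hv
  obtain ⟨e1, e2, e3⟩ := infos_erasureChannel hε hV 𝓔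
  obtain ⟨b1, b2⟩ := 𝓔.qubit_bounds
  obtain ⟨p, hp, hpd⟩ := exists_binaryEntropy_eq b2
  refine ⟨p, hp, ?_⟩
  rw [objective, e1, e2, e3, hpd]
  have h5 := mul_le_mul_of_nonneg_left b1 (mul_nonneg (by linarith : 0 ≤ 1 + mu)
    (sub_nonneg.2 hε.2))
  linarith

lemma binaryEntropy_le_one {p : ℝ} : binaryEntropy p ≤ 1 := by
  have h : binaryEntropy p = Real.binEntropy p / Real.log 2 := by
    rw [binaryEntropy_eq, Real.binEntropy_eq_negMulLog_add_negMulLog_one_sub, eta, eta, add_div]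
  rw [h, div_le_one (Real.log_pos one_lt_two)]
  exact Real.binEntropy_le_log_two

lemma binaryEntropy_nonneg {p : ℝ} (hp : p ∈ Set.Icc (0 : ℝ) (1 / 2)) : 0 ≤ binaryEntropy p := by
  have h : binaryEntropy p = Real.binEntropy p / Real.log 2 := by
    rw [binaryEntropy_eq, Real.binEntropy_eq_negMulLog_add_negMulLog_one_sub, eta, eta, add_div]
  rw [h]
  exact div_nonneg (Real.binEntropy_nonneg hp.1 (by linarith [hp.2]))
    (Real.log_pos one_lt_two).le

/-- The maximum over binary distributions is attained at `p = 0` or at `p = 1 / 2`. -/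
lemma isGreatest_image_binaryEntropy :
    IsGreatest ((fun p : ℝ => (1 - ε) + lam * (1 - 2 * ε) * binaryEntropy p
        + mu * ((1 - ε) - ε * binaryEntropy p)) '' Set.Icc (0 : ℝ) (1 / 2))
      ((1 - ε) * (1 + mu) + max 0 (lam * (1 - 2 * ε) - mu * ε)) := by
  constructor
  · rcases le_total (lam * (1 - 2 * ε) - mu * ε) 0 with h | h
    · refine ⟨0, by norm_num, ?_⟩
      simp only [binaryEntropy_zero, max_eq_left h]; ring
    · refine ⟨1 / 2, by norm_num, ?_⟩
      simp only [binaryEntropy_half, max_eq_right h]; ring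
  · rintro _ ⟨p, hp, rfl⟩
    -- The objective is affine in H₂(p), which lies in [0, 1], and this is its slope.
    have h : (lam * (1 - 2 * ε) - mu * ε) * binaryEntropy p ≤
        max 0 (lam * (1 - 2 * ε) - mu * ε) := by
      refine (mul_le_mul_of_nonneg_right (le_max_right 0 _) (binaryEntropy_nonneg hp)).trans ?_
      exact mul_le_of_le_one_right (le_max_left _ _) binaryEntropy_le_one
    simp only
    linarith

lemma isGreatest_objectiveValues_erasureChannel (hε : ε ∈ Set.Icc (0 : ℝ) 1) (hmu : 0 ≤ mu) :
    IsGreatest (objectiveValues (erasureChannel ε) lam mu)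
      ((1 - ε) * (1 + mu) + max 0 (lam * (1 - 2 * ε) - mu * ε)) := by
  have h := isGreatest_image_binaryEntropy (ε := ε) (lam := lam) (mu := mu)
  constructor
  · obtain ⟨p, hp, hpv⟩ := h.1
    rw [← hpv]
    exact mem_objectiveValues_erasureChannel hε hp
  · intro v hv
    obtain ⟨p, hp, hpv⟩ := exists_binaryEntropy_ge_objective hε hmu hv
    exact hpv.trans (h.2 ⟨p, hp, rfl⟩)

end SingleCopy

/-! ### Two copies: the upper bound and its attainment -/

section TwoCopies

variable {ε lam mu : ℝ}

/-- The sum of the entropies of the two marginals. -/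
noncomputable def marginalEntropy {K L : Type} [Fintype K] [DecidableEq K] [Fintype L]
    [DecidableEq L] (τ : Matrix (K × L) (K × L) ℂ) : ℝ :=
  scaledEntropy (traceSnd τ) + scaledEntropy (traceFst τ)

/-- The marginal terms carry the coefficient ε(1 - ε), symmetric under ε ↔ 1 - ε, so they cancel in
I(Y;B|X) - I(Y;E|X). -/
lemma infos_tensorMap_erasureChannel (hε : ε ∈ Set.Icc (0 : ℝ) 1) {E : Type} [Fintype E]
    [DecidableEq E] {V : Matrix (((Fin 2 ⊕ Unit) × (Fin 2 ⊕ Unit)) × E) (Fin 2 × Fin 2) ℂ}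
    (hV : IsIsometricExtension (tensorMap (erasureChannel ε) (erasureChannel ε)) V)
    (𝓔 : Ensemble (Fin 2 × Fin 2)) :
    infoYXB 𝓔 V = (1 - ε) ^ 2 * (𝓔.ofMean scaledEntropy - 𝓔.mean scaledEntropy)
      + ε * (1 - ε) * (𝓔.ofMean marginalEntropy - 𝓔.mean marginalEntropy) ∧
    infoYBgivenX 𝓔 V = (1 - ε) ^ 2 * (𝓔.condMean scaledEntropy - 𝓔.mean scaledEntropy)
      + ε * (1 - ε) * (𝓔.condMean marginalEntropy - 𝓔.mean marginalEntropy) ∧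
    infoYEgivenX 𝓔 V = ε ^ 2 * (𝓔.condMean scaledEntropy - 𝓔.mean scaledEntropy)
      + ε * (1 - ε) * (𝓔.condMean marginalEntropy - 𝓔.mean marginalEntropy) := by
  obtain ⟨c, hc⟩ := scaledEntropy_tensorMap_erasureChannel ε
  obtain ⟨c', hc'⟩ := scaledEntropy_tensorMap_erasureChannel (1 - ε)
  have hW := (erasureIsometry_isIsometricExtension hε).tensor
    (erasureIsometry_isIsometricExtension hε)
  refine ⟨?_, ?_, ?_⟩
  · rw [infoYXB_of_affine hV hc]
    simp only [Ensemble.ofMean, Ensemble.mean, marginalEntropy, Finset.sum_add_distrib,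
      ← Finset.mul_sum]
    ring
  · rw [infoYBgivenX_of_affine hV hc]
    simp only [Ensemble.condMean, Ensemble.mean, marginalEntropy, Finset.sum_add_distrib,
      ← Finset.mul_sum]
    ring
  · rw [infoYEgivenX_of_affine hV hW
      (traceFst_tensorIsometry (traceFst_erasureIsometry hε) (traceFst_erasureIsometry hε)) hc']
    simp only [Ensemble.condMean, Ensemble.mean, marginalEntropy, Finset.sum_add_distrib,
      ← Finset.mul_sum]
    ring

lemma logb_two_four : Real.logb 2 4 = 2 := by
  rw [show (4 : ℝ) = 2 ^ (2 : ℕ) by norm_num, Real.logb_pow, Real.logb_self_eq_one one_lt_two]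
  norm_num

lemma Ensemble.ofMean_marginalEntropy_le (𝓔 : Ensemble (Fin 2 × Fin 2)) :
    𝓔.ofMean marginalEntropy ≤ 2 := by
  have hS := 𝓔.sum_sum_weighted_posSemidef
  have h1 := scaledEntropy_le (traceSnd_posSemidef hS)
  have h2 := scaledEntropy_le (traceFst_posSemidef hS)
  rw [trace_traceSnd, 𝓔.trace_sum_weighted] at h1
  rw [trace_traceFst, 𝓔.trace_sum_weighted] at h2
  simp only [Complex.one_re, Fintype.card_fin, Nat.cast_ofNat, one_mul,
    Real.logb_self_eq_one one_lt_two] at h1 h2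
  rw [Ensemble.ofMean, marginalEntropy]
  linarith

/-- The bound on the objective for two copies in terms of the averaged joint entropies `h, a, b`
and the averaged marginal entropies `h', a', b'`. -/
lemma two_copy_objective_le {h h' a a' b b' : ℝ} (hε : ε ∈ Set.Icc (0 : ℝ) 1)
    (hmu : 0 ≤ mu) (hh : h ≤ 2) (hh' : h' ≤ 2) (hb : 0 ≤ b) (hba : b ≤ a) (ha : a ≤ 2)
    (haa' : a ≤ a') (hbb' : b ≤ b') :
    ((1 - ε) ^ 2 * (h - b) + ε * (1 - ε) * (h' - b'))
      + lam * (((1 - ε) ^ 2 * (a - b) + ε * (1 - ε) * (a' - b'))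
        - (ε ^ 2 * (a - b) + ε * (1 - ε) * (a' - b')))
      + mu * (((1 - ε) ^ 2 * (h - b) + ε * (1 - ε) * (h' - b'))
        - (ε ^ 2 * (a - b) + ε * (1 - ε) * (a' - b')))
    ≤ 2 * ((1 - ε) * (1 + mu) + max 0 (lam * (1 - 2 * ε) - mu * ε)) := by
  have hε0 := hε.1
  have hε1 : 0 ≤ 1 - ε := sub_nonneg.2 hε.2
  set c := lam * (1 - 2 * ε) - mu * ε with hc
  have hee : 0 ≤ ε * (1 - ε) := mul_nonneg hε0 hε1
  -- The b' terms combine to -ε(1 - ε)b'. After replacing h, h' by 2, a' by a and b' by b, exactly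
  -- 2(1 + μ)(1 - ε) + c(a - b) - (1 + μ)(1 - ε)b remains.
  have m1 : (1 + mu) * (1 - ε) ^ 2 * h ≤ (1 + mu) * (1 - ε) ^ 2 * 2 :=
    mul_le_mul_of_nonneg_left hh (by positivity)
  have m2 : (1 + mu) * (ε * (1 - ε)) * h' ≤ (1 + mu) * (ε * (1 - ε)) * 2 :=
    mul_le_mul_of_nonneg_left hh' (by positivity)
  have m3 : mu * (ε * (1 - ε)) * a ≤ mu * (ε * (1 - ε)) * a' :=
    mul_le_mul_of_nonneg_left haa' (by positivity)
  have m4 : ε * (1 - ε) * b ≤ ε * (1 - ε) * b' := mul_le_mul_of_nonneg_left hbb' hee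
  have m5 : 0 ≤ (1 + mu) * (1 - ε) * b := by positivity
  have key : c * (a - b) - (1 + mu) * (1 - ε) * b ≤ 2 * max 0 c := by
    have hd : max 0 c * (a - b) ≤ max 0 c * 2 :=
      mul_le_mul_of_nonneg_left (by linarith) (le_max_left _ _)
    have hd' : c * (a - b) ≤ max 0 c * (a - b) :=
      mul_le_mul_of_nonneg_right (le_max_right _ _) (by linarith)
    linarith
  rw [hc] at key ⊢
  nlinarith [m1, m2, m3, m4, key]

lemma objective_tensorMap_erasureChannel_le (hε : ε ∈ Set.Icc (0 : ℝ) 1)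
    (hmu : 0 ≤ mu) {v : ℝ} (hv : v ∈ objectiveValues
      (tensorMap (erasureChannel ε) (erasureChannel ε)) lam mu) :
    v ≤ 2 * ((1 - ε) * (1 + mu) + max 0 (lam * (1 - 2 * ε) - mu * ε)) := by
  obtain ⟨𝓔, d, V, hV, rfl⟩ := hv
  obtain ⟨e1, e2, e3⟩ := infos_tensorMap_erasureChannel hε hV 𝓔
  have hlog : Real.logb 2 (Fintype.card (Fin 2 × Fin 2)) = 2 := by
    refine (congrArg (Real.logb 2) ?_).trans logb_two_four
    norm_num
  rw [objective, e1, e2, e3]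
  exact two_copy_objective_le hε hmu (hlog ▸ 𝓔.ofMean_scaledEntropy_le)
    𝓔.ofMean_marginalEntropy_le 𝓔.mean_scaledEntropy_nonneg 𝓔.mean_le_condMean_scaledEntropy
    (hlog ▸ 𝓔.condMean_scaledEntropy_le)
    (Ensemble.condMean_mono fun τ hτ => scaledEntropy_le_add hτ)
    (Ensemble.mean_mono fun τ hτ => scaledEntropy_le_add hτ)

lemma traceSnd_single {K L : Type} [DecidableEq K] [Fintype L] [DecidableEq L] (k : K × L) (z : ℂ) :
    traceSnd (Matrix.single k k z) = Matrix.single k.1 k.1 z := by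
  obtain ⟨k, l⟩ := k
  ext i j
  simp only [traceSnd, Matrix.of_apply, Matrix.single_apply, Prod.mk.injEq]
  rw [Finset.sum_eq_single l (fun x _ hx => if_neg fun h => hx h.1.2.symm) (by simp)]
  simp

lemma traceFst_single {K L : Type} [Fintype K] [DecidableEq K] [DecidableEq L] (k : K × L) (z : ℂ) :
    traceFst (Matrix.single k k z) = Matrix.single k.2 k.2 z := by
  rw [show Matrix.single k k z = (Matrix.single k.swap k.swap z).submatrix Prod.swap Prod.swap from ?_]
  · exact traceSnd_single k.swap z
  · ext i j; simp [Matrix.single_apply]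

lemma marginalEntropy_single {K L : Type} [Fintype K] [DecidableEq K] [Fintype L] [DecidableEq L]
    (k : K × L) (p : ℝ) : marginalEntropy (Matrix.single k k (p : ℂ)) = 0 := by
  rw [marginalEntropy, traceSnd_single, traceFst_single, scaledEntropy_single,
    scaledEntropy_single, add_zero]

lemma sum_single_quarter : ∑ x : Fin (2 * 2), Matrix.single (finProdFinEquiv.symm x)
      (finProdFinEquiv.symm x) ((1 / 4 : ℝ) : ℂ) =
    Matrix.diagonal fun _ : Fin 2 × Fin 2 => ((1 / 4 : ℝ) : ℂ) := by
  rw [Fintype.sum_equiv finProdFinEquiv.symm _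
    (fun k : Fin 2 × Fin 2 => Matrix.single k k ((1 / 4 : ℝ) : ℂ)) fun _ => rfl]
  ext i j
  simp only [Matrix.sum_apply, Matrix.single_apply]
  by_cases h : i = j
  · subst h; simp
  · rw [Matrix.diagonal_apply_ne _ h]
    refine Finset.sum_eq_zero fun k _ => if_neg ?_
    rintro ⟨rfl, rfl⟩
    exact h rfl

lemma eta_quarter : eta (1 / 4) = 1 / 2 := by
  rw [eta_eq, one_div, Real.logb_inv, logb_two_four]; ring

lemma scaledEntropy_quarter :
    scaledEntropy (Matrix.diagonal fun _ : Fin 2 × Fin 2 => ((1 / 4 : ℝ) : ℂ)) = 2 := by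
  rw [scaledEntropy_diagonal]
  simp only [eta_quarter, Finset.sum_const, Finset.card_univ, Fintype.card_prod, Fintype.card_fin]
  norm_num

lemma marginalEntropy_quarter :
    marginalEntropy (Matrix.diagonal fun _ : Fin 2 × Fin 2 => ((1 / 4 : ℝ) : ℂ)) = 2 := by
  have h1 : traceSnd (Matrix.diagonal fun _ : Fin 2 × Fin 2 => ((1 / 4 : ℝ) : ℂ)) =
      Matrix.diagonal fun _ => ((1 / 2 : ℝ) : ℂ) := by
    ext i j
    fin_cases i <;> fin_cases j <;> simp [traceSnd] <;> norm_num
  have h2 : traceFst (Matrix.diagonal fun _ : Fin 2 × Fin 2 => ((1 / 4 : ℝ) : ℂ)) =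
      Matrix.diagonal fun _ => ((1 / 2 : ℝ) : ℂ) := by
    ext i j
    fin_cases i <;> fin_cases j <;> simp [traceFst] <;> norm_num
  rw [marginalEntropy, h1, h2, scaledEntropy_diagonal]
  simp only [eta_half, Finset.sum_const, Finset.card_univ, Fintype.card_fin]
  norm_num

/-- The uniform ensemble of basis states with label `X` and trivial `Y`. -/
lemma exists_ensemble_condMean_eq_zero : ∃ 𝓔 : Ensemble (Fin 2 × Fin 2),
    𝓔.ofMean scaledEntropy = 2 ∧ 𝓔.ofMean marginalEntropy = 2 ∧
    𝓔.condMean scaledEntropy = 0 ∧ 𝓔.condMean marginalEntropy = 0 ∧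
    𝓔.mean scaledEntropy = 0 ∧ 𝓔.mean marginalEntropy = 0 := by
  refine ⟨basisEnsemble (fun (_ : Fin (2 * 2)) (_ : Fin 1) => 1 / 4) (fun _ _ => by norm_num)
    (by simp) (fun x _ => finProdFinEquiv.symm x), ?_, ?_, ?_, ?_, ?_, ?_⟩
  · simp only [ofMean_basisEnsemble, Fin.sum_univ_one, sum_single_quarter, scaledEntropy_quarter]
  · simp only [ofMean_basisEnsemble, Fin.sum_univ_one, sum_single_quarter, marginalEntropy_quarter]
  · simp only [condMean_basisEnsemble, Fin.sum_univ_one, scaledEntropy_single,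
      Finset.sum_const_zero]
  · simp only [condMean_basisEnsemble, Fin.sum_univ_one, marginalEntropy_single,
      Finset.sum_const_zero]
  · simp only [mean_basisEnsemble, scaledEntropy_single, Finset.sum_const_zero]
  · simp only [mean_basisEnsemble, marginalEntropy_single, Finset.sum_const_zero]

/-- The uniform ensemble of basis states with label `Y` and trivial `X`. -/
lemma exists_ensemble_condMean_eq_two : ∃ 𝓔 : Ensemble (Fin 2 × Fin 2),
    𝓔.ofMean scaledEntropy = 2 ∧ 𝓔.ofMean marginalEntropy = 2 ∧
    𝓔.condMean scaledEntropy = 2 ∧ 𝓔.condMean marginalEntropy = 2 ∧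
    𝓔.mean scaledEntropy = 0 ∧ 𝓔.mean marginalEntropy = 0 := by
  refine ⟨basisEnsemble (fun (_ : Fin 1) (_ : Fin (2 * 2)) => 1 / 4) (fun _ _ => by norm_num)
    (by simp) (fun _ y => finProdFinEquiv.symm y), ?_, ?_, ?_, ?_, ?_, ?_⟩
  · simp only [ofMean_basisEnsemble, Fin.sum_univ_one, sum_single_quarter, scaledEntropy_quarter]
  · simp only [ofMean_basisEnsemble, Fin.sum_univ_one, sum_single_quarter, marginalEntropy_quarter]
  · simp only [condMean_basisEnsemble, Fin.sum_univ_one, sum_single_quarter,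
      scaledEntropy_quarter]
  · simp only [condMean_basisEnsemble, Fin.sum_univ_one, sum_single_quarter,
      marginalEntropy_quarter]
  · simp only [mean_basisEnsemble, scaledEntropy_single, Finset.sum_const_zero]
  · simp only [mean_basisEnsemble, marginalEntropy_single, Finset.sum_const_zero]

lemma isGreatest_objectiveValues_tensorMap_erasureChannel (hε : ε ∈ Set.Icc (0 : ℝ) 1)
    (hmu : 0 ≤ mu) :
    IsGreatest (objectiveValues (tensorMap (erasureChannel ε) (erasureChannel ε)) lam mu)
      (2 * ((1 - ε) * (1 + mu) + max 0 (lam * (1 - 2 * ε) - mu * ε))) := by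
  refine ⟨?_, fun v hv => objective_tensorMap_erasureChannel_le hε hmu hv⟩
  obtain ⟨d, V, hV⟩ := ((erasureIsometry_isIsometricExtension hε).tensor
    (erasureIsometry_isIsometricExtension hε)).exists_fin
  -- The sign of the slope decides whether the randomness belongs in X, which makes a = a' = 0, or
  -- in Y, which makes a = a' = 2.
  rcases le_total (lam * (1 - 2 * ε) - mu * ε) 0 with h | h
  · obtain ⟨𝓔, v1, v2, v3, v4, v5, v6⟩ := exists_ensemble_condMean_eq_zero
    obtain ⟨e1, e2, e3⟩ := infos_tensorMap_erasureChannel hε hV 𝓔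
    refine ⟨𝓔, d, V, hV, ?_⟩
    rw [objective, e1, e2, e3, v1, v2, v3, v4, v5, v6, max_eq_left h]
    ring
  · obtain ⟨𝓔, v1, v2, v3, v4, v5, v6⟩ := exists_ensemble_condMean_eq_two
    obtain ⟨e1, e2, e3⟩ := infos_tensorMap_erasureChannel hε hV 𝓔
    refine ⟨𝓔, d, V, hV, ?_⟩
    rw [objective, e1, e2, e3, v1, v2, v3, v4, v5, v6, max_eq_right h]
    ring

end TwoCopies

end PrivateDynamic

theorem mainTheorem9 (ε lam mu : ℝ) (hε : ε ∈ Set.Icc (0 : ℝ) 1) (hlam : 0 ≤ lam) (hmu : 0 ≤ mu) :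
    -- the maximum that defines the formula for the erasure channel is attained
    IsGreatest (PrivateDynamic.objectiveValues (PrivateDynamic.erasureChannel ε) lam mu)
      (PrivateDynamic.capacityFormula (PrivateDynamic.erasureChannel ε) lam mu) ∧
    -- and it equals the maximum over binary distributions
    IsGreatest
      ((fun p : ℝ => (1 - ε) + lam * (1 - 2 * ε) * PrivateDynamic.binaryEntropy p
          + mu * ((1 - ε) - ε * PrivateDynamic.binaryEntropy p)) '' Set.Icc (0 : ℝ) (1 / 2))
      (PrivateDynamic.capacityFormula (PrivateDynamic.erasureChannel ε) lam mu) ∧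
    -- the one-shot region
    PrivateDynamic.oneShotRegion (PrivateDynamic.erasureChannel ε) =
      {r : ℝ × ℝ × ℝ | ∃ p ∈ Set.Icc (0 : ℝ) (1 / 2),
        r.1 + r.2.1 ≤ 1 - ε ∧
        r.2.1 + r.2.2 ≤ (1 - 2 * ε) * PrivateDynamic.binaryEntropy p ∧
        r.1 + r.2.1 + r.2.2 ≤ 1 - ε - ε * PrivateDynamic.binaryEntropy p} ∧
    -- additivity for two copies, where the maximum is again attained
    IsGreatest
      (PrivateDynamic.objectiveValues
        (PrivateDynamic.tensorMap (PrivateDynamic.erasureChannel ε)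
          (PrivateDynamic.erasureChannel ε)) lam mu)
      (PrivateDynamic.capacityFormula
        (PrivateDynamic.tensorMap (PrivateDynamic.erasureChannel ε)
          (PrivateDynamic.erasureChannel ε)) lam mu) ∧
    PrivateDynamic.capacityFormula
        (PrivateDynamic.tensorMap (PrivateDynamic.erasureChannel ε)
          (PrivateDynamic.erasureChannel ε)) lam mu =
      PrivateDynamic.capacityFormula (PrivateDynamic.erasureChannel ε) lam mu +
        PrivateDynamic.capacityFormula (PrivateDynamic.erasureChannel ε) lam mu := by
  have h1 := PrivateDynamic.isGreatest_objectiveValues_erasureChannel (lam := lam) hε hmu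
  have h2 := PrivateDynamic.isGreatest_objectiveValues_tensorMap_erasureChannel (lam := lam) hε hmu
  have e1 : PrivateDynamic.capacityFormula (PrivateDynamic.erasureChannel ε) lam mu = _ :=
    h1.csSup_eq
  have e2 : PrivateDynamic.capacityFormula (PrivateDynamic.tensorMap
    (PrivateDynamic.erasureChannel ε) (PrivateDynamic.erasureChannel ε)) lam mu = _ := h2.csSup_eq
  -- Both suprema are now explicit, and the second is twice the first.
  rw [e1, e2]
  exact ⟨h1, PrivateDynamic.isGreatest_image_binaryEntropy,
    PrivateDynamic.oneShotRegion_erasureChannel hε, h2, two_mul _⟩
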